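/- Let $(\Omega,\mathcal F,\mathbb P)$ be a probability space with an ergodic invertible measure-preserving transformation $T:\Omega\to\Omega$ (with measurable inverse), and write $T_y=T^y$ for $y\in\mathbb Z$. Let $V:\Omega\to[0,1]$ be measurable, with essential infimum $0$ and essential supremum $1$ under $\mathbb P$, and assume that for every $h\in(0,1)$ and every integer $\ell\ge 1$ $$\mathbb P\bigl(V(T_y\omega)\le h\text{ for all integers }0\le y\le\ell\bigr)>0\quad\text{and}\quad \mathbb P\bigl(V(T_y\omega)\ge h\text{ for all integers }0\le y\le\ell\bigr)>0 .$$ Let $E_0$ be the expectation for simple symmetric random walk $(X_i)_{i\ge0}$ on $\mathbb Z$ with $X_0=0$, and let $\mathbb E$ be the expectation under $\mathbb P$. Then for every $\beta>0$ and $\theta\in\mathbb R$ there is a deterministic real number $\Lambda_\beta(\theta)$, the tilted free energy, such that $$\Lambda_\beta(\theta)=\lim_{n\to\infty}\frac1n\log E_0\Bigl[e^{\beta\sum_{i=0}^{n-1}V(T_{X_i}\omega)+\theta X_n}\Bigr]\quad\text{for }\mathbb P\text{-a.e. }\omega,$$ and the following hold. (a) For every $\theta\in\mathbb R$, $\Lambda_\beta(\theta)$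 is strictly increasing in $\beta\in(0,\infty)$. For every $\beta>0$, $\Lambda_\beta(\theta)$ is even and convex in $\theta\in\mathbb R$. For every $\beta>0$, moreover: (b) $\Lambda_\beta(\theta)\ge\max\{\beta,\ \beta\,\mathbb E[V]+\log\cosh\theta\}$ for every $\theta\in\mathbb R$. (c) If $|\theta|\le\beta(1-\mathbb E[V])$, then $\Lambda_\beta(\theta)=\beta$. The set $\{\theta\in\mathbb R:\Lambda_\beta(\theta)=\beta\}$ is a symmetric closed interval $[-b,b]$ with $b>0$. (d) $\Lambda_\beta(\theta)-\log\cosh\theta\to\beta\,\mathbb E[V]$ as $|\theta|\to\infty$. (e) The map $\theta\mapsto\Lambda_\beta(\theta)$ is continuously differentiable on the complement of $\{\theta\in\mathbb R:\Lambda_\beta(\theta)=\beta\}$. -/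

import Mathlib

open MeasureTheory Filter Topology Set

noncomputable section

namespace RWRP

/-- The shift `T_y`, for `y : ℤ`: the `y`-th (possibly negative) power of the invertible
transformation `T` under composition. -/
def shift {Ω : Type*} [MeasurableSpace Ω] (T : Ω ≃ᵐ Ω) (y : ℤ) : Ω → Ω :=
  ⇑((T.toEquiv : Equiv.Perm Ω) ^ y)

/-- The integer interval `[k, l]` is an `h`-valley of the potential in the environment `ω`. -/
def IsValley {Ω : Type*} [MeasurableSpace Ω] (T : Ω ≃ᵐ Ω) (V : Ω → ℝ) (ω : Ω) (h : ℝ)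
    (k l : ℤ) : Prop :=
  ∀ y ∈ Icc k l, V (shift T y ω) ≤ h

/-- The integer interval `[k, l]` is an `h`-hill of the potential in the environment `ω`. -/
def IsHill {Ω : Type*} [MeasurableSpace Ω] (T : Ω ≃ᵐ Ω) (V : Ω → ℝ) (ω : Ω) (h : ℝ)
    (k l : ℤ) : Prop :=
  ∀ y ∈ Icc k l, h ≤ V (shift T y ω)

/-- The position `X_i` at time `i` of the nearest-neighbour path on `ℤ` that starts at `0` and has
the steps `z 0, …, z (n - 1)`, each of them `1` or `-1` (a unit of `ℤ`). -/
def pos {n : ℕ} (z : Fin n → ℤˣ) (i : ℕ) : ℤ :=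
  ∑ j : Fin n, if (j : ℕ) < i then (z j : ℤ) else 0

/-- Expectation `E_0` over the first `n` steps of simple symmetric random walk on `ℤ` started
at `0`: each of the `2 ^ n` sequences of steps has probability `∏ 1/2`. -/
def walkExp (n : ℕ) (f : (Fin n → ℤˣ) → ℝ) : ℝ :=
  ∑ z : Fin n → ℤˣ, (∏ _i : Fin n, (1 / 2 : ℝ)) * f z

/-- `E_0 [exp (β ∑_{i < n} V (T_{X_i} ω) + θ X_n)]`. -/
def partitionFn {Ω : Type*} [MeasurableSpace Ω] (T : Ω ≃ᵐ Ω) (V : Ω → ℝ) (β θ : ℝ) (n : ℕ)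
    (ω : Ω) : ℝ :=
  walkExp n fun z =>
    Real.exp (β * ∑ i ∈ Finset.range n, V (shift T (pos z i) ω) + θ * (pos z n : ℝ))

/-- For almost every environment, `(1/n) log E_0 [exp (β ∑_{i < n} V (T_{X_i} ω) + θ X_n)]`
converges to the deterministic number `L`. -/
def IsTiltedFreeEnergy {Ω : Type*} [MeasurableSpace Ω] (μ : Measure Ω) (T : Ω ≃ᵐ Ω) (V : Ω → ℝ)
    (β θ L : ℝ) : Prop :=
  ∀ᵐ ω ∂μ, Tendsto (fun n : ℕ => 1 / (n : ℝ) * Real.log (partitionFn T V β θ n ω)) atTop (𝓝 L)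

/-- The tilted free energy `Λ_β(θ)`: the almost sure limit of
`(1/n) log E_0 [exp (β ∑_{i < n} V (T_{X_i} ω) + θ X_n)]`. For a probability measure there is at
most one such limit; if there is none, the value is arbitrary. -/
def tiltedFreeEnergy {Ω : Type*} [MeasurableSpace Ω] (μ : Measure Ω) (T : Ω ≃ᵐ Ω) (V : Ω → ℝ)
    (β θ : ℝ) : ℝ :=
  Classical.epsilon fun L => IsTiltedFreeEnergy μ T V β θ L

end RWRP

end

/-!
The partition function `E_0 [exp (β ∑ V + θ X_n)]` is the `n`-th iterate of a transfer operator on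
functions on `ℤ`, applied to `exp (θ x)` (`partitionFn_eq_iterate`). In one dimension, for every
level `l > β`, this operator has a positive solution `u` with eigenvalue `exp l` whose increments
`p = log (u (x + 1) / u (x))` are stationary: `exp (-p)` is an infinite continued fraction in the
environment (`contFracLim`), which converges because `V ≤ 1`. By the ergodic theorem, which is
proved here for bounded observables (`ae_abs_birkhoffSum_sub_le`), `u` grows like `exp (a x)` in
both directions, with the Lyapunov exponent `a = a(l) = 𝔼 [p]` (`lyapunov`). Replacing
`exp (a x)` by `u` costs a subexponential factor, so the free energy at tilt `a(l)` is `l`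
(`isTiltedFreeEnergy_lyapunov`). The mirror image of the argument gives the tilt `-a(l)`, since left
and right solutions have the same exponent; this is read off from their Wronskian
(`lyapunov_sub_lyapunov`), and so is the derivative of `a`, which is continuous and at least `1`
(`hasDerivAt_lyapunov`). Tilts with `|θ| ≤ b`, where `b` is the infimum of `a` (`critTilt`), have
free energy `β`: the upper bound comes from the tilts `±a(l)` with `l` close to `β`, the lower bound
from walks that stay on a long high hill (`isTiltedFreeEnergy_flat`). So the free energy equals `β`
on `[-b, b]`, and outside it is the inverse of `a`, up to reflection. This gives evenness and
continuous differentiability off the flat piece.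

The quantitative statements follow from `l - β 𝔼 [V] = 𝔼 [log cosh q]`
(`integral_log_cosh_meanRatio`), where `q` is the mean of two neighbouring increments, so that
`𝔼 [q] = a(l)` and `q ≥ l - β`. Jensen's inequality gives the lower bound on the free energy,
`log cosh q ≤ q` the lower bound on `b`, and `log cosh q = q - log 2 + O (exp (-2 q))` the
asymptotics at large tilts. Convexity in the tilt is Hölder's inequality; jointly with the inverse
temperature it also yields strict monotonicity in `β`, because the free energy at `β > 0` exceeds
its value `log cosh θ` at `β = 0`.
-/

noncomputable section
namespace RWRP

/-! ### The pointwise ergodic theorem for bounded observables -/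

/-- The maximum of `0` and of the first `n` Birkhoff sums of `f`, in the recursive form
`M (n + 1) = max 0 (f + M n ∘ S)`. -/
def maxSum {Ω : Type*} (S : Ω → Ω) (f : Ω → ℝ) : ℕ → Ω → ℝ
  | 0, _ => 0
  | n + 1, ω => max 0 (f ω + maxSum S f n (S ω))

section Ergodic

variable {Ω : Type*}

theorem maxSum_nonneg (S : Ω → Ω) (f : Ω → ℝ) (n : ℕ) (ω : Ω) : 0 ≤ maxSum S f n ω := by
  cases n <;> simp [maxSum]

theorem maxSum_le_succ (S : Ω → Ω) (f : Ω → ℝ) (n : ℕ) (ω : Ω) :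
    maxSum S f n ω ≤ maxSum S f (n + 1) ω := by
  induction n generalizing ω with
  | zero => exact maxSum_nonneg S f 1 ω
  | succ n ih =>
    simp only [maxSum] at ih ⊢
    exact max_le_max le_rfl (add_le_add le_rfl (ih (S ω)))

theorem birkhoffSum_le_maxSum (S : Ω → Ω) (f : Ω → ℝ) (n : ℕ) (ω : Ω) :
    birkhoffSum S f n ω ≤ maxSum S f n ω := by
  induction n generalizing ω with
  | zero => simp [maxSum]
  | succ n ih =>
    rw [birkhoffSum_succ']
    exact (add_le_add le_rfl (ih (S ω))).trans (le_max_right _ _)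

theorem maxSum_le {S : Ω → Ω} {f : Ω → ℝ} {C : ℝ} (hC : ∀ ω, |f ω| ≤ C) (n : ℕ) (ω : Ω) :
    maxSum S f n ω ≤ n * C := by
  induction n generalizing ω with
  | zero => simp [maxSum]
  | succ n ih =>
    have h0 : 0 ≤ C := (abs_nonneg _).trans (hC ω)
    have h1 := (abs_le.1 (hC ω)).2
    have h2 := ih (S ω)
    push_cast
    refine max_le (by positivity) (by linarith)

variable [MeasurableSpace Ω]

theorem measurable_maxSum {S : Ω → Ω} (hS : Measurable S) {f : Ω → ℝ} (hf : Measurable f)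
    (n : ℕ) : Measurable (maxSum S f n) := by
  induction n with
  | zero => exact measurable_const
  | succ n ih => exact measurable_const.max (hf.add (ih.comp hS))

/-- A bounded measurable function on a probability space is integrable. -/
theorem integrable_of_abs_le {μ : Measure Ω} [IsFiniteMeasure μ] {f : Ω → ℝ}
    (hf : Measurable f) {C : ℝ} (hC : ∀ ω, |f ω| ≤ C) : Integrable f μ :=
  Integrable.of_bound hf.aestronglyMeasurable C (ae_of_all _ hC)

/-- If the maxima `M n` were almost surely unbounded, then `M (n + 1) - M n ∘ S` would decrease
to `f`, although its integral `∫ M (n + 1) - ∫ M n` is nonnegative. -/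
theorem ae_bddAbove_maxSum {μ : Measure Ω} [IsProbabilityMeasure μ] {S : Ω → Ω}
    (hS : Ergodic S μ) {f : Ω → ℝ} (hf : Measurable f) {C : ℝ} (hC : ∀ ω, |f ω| ≤ C)
    (hneg : ∫ ω, f ω ∂μ < 0) :
    ∀ᵐ ω ∂μ, BddAbove (range fun n => maxSum S f n ω) := by
  have hSm := hS.measurable
  have hM := measurable_maxSum hSm hf
  have hmeas : MeasurableSet {ω | BddAbove (range fun n => maxSum S f n ω)} :=
    measurableSet_bddAbove_range hM
  have hinv : S ⁻¹' {ω | BddAbove (range fun n => maxSum S f n ω)} =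
      {ω | BddAbove (range fun n => maxSum S f n ω)} := by
    ext ω
    simp only [mem_preimage, mem_ofPred_eq]
    constructor
    · rintro ⟨B, hB⟩
      refine ⟨max 0 (f ω + B), ?_⟩
      rintro _ ⟨n, rfl⟩
      cases n with
      | zero => exact le_max_left _ _
      | succ n => exact max_le_max le_rfl (add_le_add le_rfl (hB ⟨n, rfl⟩))
    · rintro ⟨B, hB⟩
      refine ⟨B - f ω, ?_⟩
      rintro _ ⟨n, rfl⟩
      have h1 : f ω + maxSum S f n (S ω) ≤ B := (le_max_right _ _).trans (hB ⟨n + 1, rfl⟩)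
      show maxSum S f n (S ω) ≤ B - f ω
      linarith
  rcases hS.ae_mem_or_ae_notMem hmeas hinv with h | h
  · exact h
  exfalso
  have hMint : ∀ n, Integrable (maxSum S f n) μ := fun n =>
    integrable_of_abs_le (hM n) (C := n * C) fun ω => by
      rw [abs_of_nonneg (maxSum_nonneg S f n ω)]; exact maxSum_le hC n ω
  have hid : ∀ n ω, maxSum S f (n + 1) ω - maxSum S f n (S ω) =
      max (-maxSum S f n (S ω)) (f ω) := by
    intro n ω
    simp only [maxSum]
    rw [sub_eq_add_neg, max_add, zero_add]
    congr 1
    ring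
  have hnn : ∀ n, 0 ≤ ∫ ω, max (-maxSum S f n (S ω)) (f ω) ∂μ := by
    intro n
    have hcomp : Integrable (fun ω => maxSum S f n (S ω)) μ :=
      hS.toMeasurePreserving.integrable_comp_of_integrable (hMint n)
    have h1 : ∫ ω, maxSum S f n (S ω) ∂μ = ∫ ω, maxSum S f n ω ∂μ := by
      have := integral_map (μ := μ) hSm.aemeasurable (f := maxSum S f n)
        (by rw [hS.map_eq]; exact (hM n).aestronglyMeasurable)
      rw [hS.map_eq] at this
      exact this.symm
    rw [← integral_congr_ae (ae_of_all _ (hid n)), integral_sub (hMint _) hcomp, h1, sub_nonneg]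
    exact integral_mono (hMint n) (hMint (n + 1)) (maxSum_le_succ S f n)
  have hlim : Tendsto (fun n => ∫ ω, max (-maxSum S f n (S ω)) (f ω) ∂μ) atTop
      (𝓝 (∫ ω, f ω ∂μ)) := by
    refine tendsto_integral_of_dominated_convergence (fun _ => C)
      (fun n => (((hM n).comp hSm).neg.max hf).aestronglyMeasurable) (integrable_const _) ?_ ?_
    · intro n
      refine ae_of_all _ fun ω => ?_
      have h0 := maxSum_nonneg S f n (S ω)
      have h1 := abs_le.1 (hC ω)
      have h2 : 0 ≤ C := (abs_nonneg _).trans (hC ω)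
      rw [Real.norm_eq_abs, abs_le]
      exact ⟨h1.1.trans (le_max_right _ _), max_le (by linarith) h1.2⟩
    · have h' : ∀ᵐ ω ∂μ, ¬ BddAbove (range fun n => maxSum S f n (S ω)) := by
        filter_upwards [h] with ω hω hb
        have hmem : ω ∈ S ⁻¹' {ω | BddAbove (range fun n => maxSum S f n ω)} := hb
        rw [hinv] at hmem
        exact hω hmem
      filter_upwards [h'] with ω hω
      refine tendsto_const_nhds.congr' ?_
      obtain ⟨N, hN⟩ : ∃ N, -f ω < maxSum S f N (S ω) := by
        by_contra! hcon
        exact hω ⟨-f ω, by rintro _ ⟨n, rfl⟩; exact hcon n⟩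
      filter_upwards [eventually_ge_atTop N] with n hn
      have : maxSum S f N (S ω) ≤ maxSum S f n (S ω) :=
        monotone_nat_of_le_succ (f := fun n => maxSum S f n (S ω))
          (fun n => maxSum_le_succ S f n (S ω)) hn
      exact (max_eq_right (by linarith)).symm
  exact absurd (ge_of_tendsto' hlim hnn) (not_le.2 hneg)

theorem ae_birkhoffSum_le {μ : Measure Ω} [IsProbabilityMeasure μ] {S : Ω → Ω}
    (hS : Ergodic S μ) {f : Ω → ℝ} (hf : Measurable f) {C : ℝ} (hC : ∀ ω, |f ω| ≤ C)
    {c : ℝ} (hc : ∫ ω, f ω ∂μ < c) :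
    ∀ᵐ ω ∂μ, ∃ B, ∀ n : ℕ, birkhoffSum S f n ω ≤ c * n + B := by
  have hb := ae_bddAbove_maxSum (μ := μ) hS (hf.sub_const c) (C := C + |c|)
    (fun ω => (abs_sub _ _).trans (add_le_add (hC ω) le_rfl)) (by
      rw [integral_sub (integrable_of_abs_le hf hC) (integrable_const _)]
      simpa using hc)
  filter_upwards [hb] with ω ⟨B, hB⟩
  refine ⟨B, fun n => ?_⟩
  have h1 := (birkhoffSum_le_maxSum S (fun ω => f ω - c) n ω).trans (hB ⟨n, rfl⟩)
  have h2 : birkhoffSum S (fun ω => f ω - c) n ω = birkhoffSum S f n ω - c * n := by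
    simp [birkhoffSum, Finset.sum_sub_distrib, mul_comm]
  linarith

/-- The pointwise ergodic theorem for a bounded observable, as a bound on the Birkhoff sums that
holds for all `n`. -/
theorem ae_abs_birkhoffSum_sub_le {μ : Measure Ω} [IsProbabilityMeasure μ] {S : Ω → Ω}
    (hS : Ergodic S μ) {f : Ω → ℝ} (hf : Measurable f) {C : ℝ} (hC : ∀ ω, |f ω| ≤ C) :
    ∀ᵐ ω ∂μ, ∀ ε : ℝ, 0 < ε → ∃ B, ∀ n : ℕ,
      |birkhoffSum S f n ω - (∫ ω, f ω ∂μ) * n| ≤ ε * n + B := by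
  have key : ∀ᵐ ω ∂μ, ∀ k : ℕ, ∃ B, ∀ n : ℕ,
      |birkhoffSum S f n ω - (∫ ω, f ω ∂μ) * n| ≤ 1 / ((k : ℝ) + 1) * n + B := by
    refine ae_all_iff.2 fun k => ?_
    have hk : 0 < 1 / ((k : ℝ) + 1) := by positivity
    have h1 := ae_birkhoffSum_le (μ := μ) hS hf hC (lt_add_of_pos_right _ hk)
    have h2 := ae_birkhoffSum_le (μ := μ) hS hf.neg (C := C) (fun ω => by simpa using hC ω)
      (c := -(∫ ω, f ω ∂μ) + 1 / ((k : ℝ) + 1))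
      (by simp only [Pi.neg_apply, integral_neg]; linarith)
    filter_upwards [h1, h2] with ω ⟨B₁, h1⟩ ⟨B₂, h2⟩
    refine ⟨max B₁ B₂, fun n => abs_le.2 ⟨?_, ?_⟩⟩
    · have := h2 n
      have e : birkhoffSum S (-f) n ω = -birkhoffSum S f n ω := by simp [birkhoffSum]
      rw [e] at this
      have := le_max_right B₁ B₂
      linarith
    · have := h1 n
      have := le_max_left B₁ B₂
      linarith
  filter_upwards [key] with ω hω ε hε
  obtain ⟨k, hk⟩ := exists_nat_one_div_lt hε
  obtain ⟨B, hB⟩ := hω k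
  exact ⟨B, fun n => (hB n).trans (by gcongr)⟩

/-- An event of positive probability is visited by almost every orbit of an ergodic map. -/
theorem ae_exists_iterate_mem {μ : Measure Ω} [IsProbabilityMeasure μ] {S : Ω → Ω}
    (hS : Ergodic S μ) {E : Set Ω} (hE : MeasurableSet E) (hpos : 0 < μ E) :
    ∀ᵐ ω ∂μ, ∃ n : ℕ, S^[n] ω ∈ E := by
  set U : Set Ω := ⋃ n : ℕ, S^[n] ⁻¹' E with hU
  have hUm : MeasurableSet U := .iUnion fun n => (hS.measurable.iterate n) hE
  have hsub : S ⁻¹' U ⊆ U := by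
    intro ω hω
    obtain ⟨n, hn⟩ := mem_iUnion.1 (mem_preimage.1 hω)
    exact mem_iUnion.2 ⟨n + 1, by simpa [Function.iterate_succ_apply] using hn⟩
  rcases hS.ae_empty_or_univ_of_preimage_ae_le hUm.nullMeasurableSet hsub.eventuallyLE with h | h
  · exfalso
    have h0 : μ U = 0 := by rw [measure_congr h, measure_empty]
    exact hpos.ne' (measure_mono_null (fun ω hω => mem_iUnion.2 ⟨0, hω⟩) h0)
  · filter_upwards [eventuallyEq_univ.1 h] with ω hω
    simpa [hU] using hω

end Ergodic

/-! ### Log-convexity of exponential sums -/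

/-- Hölder's inequality for a finite exponential sum, in logarithmic form. -/
theorem log_sum_exp_convex {ι : Type*} (s : Finset ι) (hs : s.Nonempty) (w A B : ι → ℝ)
    (hw : ∀ i ∈ s, 0 < w i) {a b : ℝ} (ha : 0 ≤ a) (hb : 0 ≤ b) (hab : a + b = 1) :
    Real.log (∑ i ∈ s, w i * Real.exp (a * A i + b * B i)) ≤
      a * Real.log (∑ i ∈ s, w i * Real.exp (A i)) +
        b * Real.log (∑ i ∈ s, w i * Real.exp (B i)) := by
  have hpos : ∀ D : ι → ℝ, 0 < ∑ i ∈ s, w i * Real.exp (D i) := fun D =>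
    Finset.sum_pos (fun i hi => mul_pos (hw i hi) (Real.exp_pos _)) hs
  set P := ∑ i ∈ s, w i * Real.exp (A i) with hP
  set Q := ∑ i ∈ s, w i * Real.exp (B i) with hQ
  have hPp : 0 < P := hpos A
  have hQp : 0 < Q := hpos B
  have key : ∑ i ∈ s, w i * Real.exp (a * A i + b * B i) ≤
      Real.exp (a * Real.log P + b * Real.log Q) := by
    -- after normalisation both sums are `1`, and convexity of `exp` applies term by term
    have hterm : ∀ i ∈ s, w i * Real.exp (a * A i + b * B i) ≤
        Real.exp (a * Real.log P + b * Real.log Q) *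
          (a * (w i * Real.exp (A i) / P) + b * (w i * Real.exp (B i) / Q)) := by
      intro i hi
      have hc := convexOn_exp.2 (mem_univ (A i - Real.log P)) (mem_univ (B i - Real.log Q))
        ha hb hab
      simp only [smul_eq_mul, Real.exp_sub, Real.exp_log hPp, Real.exp_log hQp] at hc
      have e : Real.exp (a * A i + b * B i) = Real.exp (a * Real.log P + b * Real.log Q) *
          Real.exp (a * (A i - Real.log P) + b * (B i - Real.log Q)) := by
        rw [← Real.exp_add]; congr 1; ring
      rw [e]
      calc _ = Real.exp (a * Real.log P + b * Real.log Q) * (w i *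
              Real.exp (a * (A i - Real.log P) + b * (B i - Real.log Q))) := by ring
        _ ≤ Real.exp (a * Real.log P + b * Real.log Q) * (w i *
              (a * (Real.exp (A i) / P) + b * (Real.exp (B i) / Q))) := by
            have := (hw i hi).le
            gcongr
        _ = _ := by ring
    refine (Finset.sum_le_sum hterm).trans_eq ?_
    rw [← Finset.mul_sum, Finset.sum_add_distrib, ← Finset.mul_sum, ← Finset.mul_sum,
      ← Finset.sum_div, ← Finset.sum_div, ← hP, ← hQ, div_self hPp.ne', div_self hQp.ne']
    simp [hab]
  calc _ ≤ Real.log (Real.exp (a * Real.log P + b * Real.log Q)) :=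
        Real.log_le_log (hpos _) key
    _ = _ := Real.log_exp _

theorem convexOn_log_cosh : ConvexOn ℝ univ fun t => Real.log (Real.cosh t) := by
  refine ⟨convex_univ, fun x _ y _ a b ha hb hab => ?_⟩
  have h := log_sum_exp_convex (Finset.univ : Finset Bool) Finset.univ_nonempty (fun _ => 1 / 2)
    (fun i => if i then x else -x) (fun i => if i then y else -y) (by simp) ha hb hab
  have e : ∀ t : ℝ, Real.cosh t = 1 / 2 * Real.exp t + 1 / 2 * Real.exp (-t) := fun t => by
    rw [Real.cosh_eq]; ring
  simp only [smul_eq_mul, e]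
  simpa [Fintype.sum_bool, neg_add, mul_neg, add_comm (-(b * y))] using h

theorem log_cosh_le_abs (t : ℝ) : Real.log (Real.cosh t) ≤ |t| := by
  rw [← Real.cosh_abs, Real.log_le_iff_le_exp (Real.cosh_pos _)]
  rw [Real.cosh_eq]
  have : Real.exp (-|t|) ≤ Real.exp |t| := Real.exp_le_exp.2 (by linarith [abs_nonneg t])
  linarith

theorem sub_log_two_le_log_cosh (t : ℝ) : t - Real.log 2 ≤ Real.log (Real.cosh t) := by
  rw [Real.le_log_iff_exp_le (Real.cosh_pos _), Real.exp_sub, Real.exp_log two_pos, Real.cosh_eq]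
  have := (Real.exp_pos (-t)).le
  gcongr
  linarith

theorem log_cosh_le_sub_log_two_add (t : ℝ) :
    Real.log (Real.cosh t) ≤ t - Real.log 2 + Real.exp (-(2 * t)) := by
  have e : Real.cosh t = Real.exp t / 2 * (1 + Real.exp (-(2 * t))) := by
    have e1 : Real.exp (-t) = Real.exp t * Real.exp (-(2 * t)) := by
      rw [← Real.exp_add]; ring_nf
    rw [Real.cosh_eq, e1]; ring
  have h := Real.log_le_sub_one_of_pos (show 0 < 1 + Real.exp (-(2 * t)) by positivity)
  rw [e, Real.log_mul (by positivity) (by positivity), Real.log_div (by positivity) two_ne_zero,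
    Real.log_exp]
  linarith

/-! ### Stationary continued fractions -/

/-- The finite continued fractions `1 / (K ω - 1 / (K (S ω) - 1 / (K (S² ω) - ⋯)))`, truncated
at depth `n`. -/
def contFrac {Ω : Type*} (K : Ω → ℝ) (S : Ω → Ω) : ℕ → Ω → ℝ
  | 0, _ => 0
  | n + 1, ω => (K ω - contFrac K S n (S ω))⁻¹

/-- The infinite continued fraction, the limit of the increasing sequence `contFrac K S n` when
`K ≥ 2`. It is a solution of `G ω = 1 / (K ω - G (S ω))`. With `K = 2 exp (l - β V)` and `S` the
inverse of the shift it is the expectation of `exp (∑ (β V - l))` over the path of the random walk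
up to the hitting time of the right neighbour of its starting point. -/
def contFracLim {Ω : Type*} (K : Ω → ℝ) (S : Ω → Ω) (ω : Ω) : ℝ := ⨆ n, contFrac K S n ω

section ContFrac

variable {Ω : Type*} {K : Ω → ℝ} {S : Ω → Ω} {y : ℝ}

theorem contFrac_mem (hy : 1 ≤ y) (hK : ∀ ω, 2 * y ≤ K ω) (n : ℕ) (ω : Ω) :
    0 ≤ contFrac K S n ω ∧ contFrac K S n ω ≤ y⁻¹ := by
  have h1 : y⁻¹ ≤ 1 := inv_le_one_of_one_le₀ hy
  have h0 : 0 < y⁻¹ := by positivity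
  induction n generalizing ω with
  | zero => exact ⟨le_rfl, h0.le⟩
  | succ n ih =>
    have hd : y ≤ K ω - contFrac K S n (S ω) := by linarith [(ih (S ω)).2, hK ω]
    exact ⟨inv_nonneg.2 (by linarith), inv_anti₀ (by linarith) hd⟩

theorem le_sub_contFrac (hy : 1 ≤ y) (hK : ∀ ω, 2 * y ≤ K ω) (n : ℕ) (ω ω' : Ω) :
    y ≤ K ω - contFrac K S n ω' := by
  have h1 : y⁻¹ ≤ 1 := inv_le_one_of_one_le₀ hy
  linarith [(contFrac_mem (S := S) hy hK n ω').2, hK ω]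

theorem contFrac_le_succ (hy : 1 ≤ y) (hK : ∀ ω, 2 * y ≤ K ω) (n : ℕ) (ω : Ω) :
    contFrac K S n ω ≤ contFrac K S (n + 1) ω := by
  induction n generalizing ω with
  | zero => exact (contFrac_mem hy hK 1 ω).1
  | succ n ih =>
    have h := le_sub_contFrac (S := S) hy hK (n + 1) ω (S ω)
    exact inv_anti₀ (by linarith) (by linarith [ih (S ω)])

theorem tendsto_contFrac (hy : 1 ≤ y) (hK : ∀ ω, 2 * y ≤ K ω) (ω : Ω) :
    Tendsto (fun n => contFrac K S n ω) atTop (𝓝 (contFracLim K S ω)) :=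
  tendsto_atTop_ciSup (monotone_nat_of_le_succ fun n => contFrac_le_succ hy hK n ω)
    ⟨y⁻¹, by rintro _ ⟨n, rfl⟩; exact (contFrac_mem hy hK n ω).2⟩

theorem contFracLim_le (hy : 1 ≤ y) (hK : ∀ ω, 2 * y ≤ K ω) (ω : Ω) :
    contFracLim K S ω ≤ y⁻¹ :=
  le_of_tendsto' (tendsto_contFrac hy hK ω) fun n => (contFrac_mem hy hK n ω).2

theorem contFracLim_eq (hy : 1 ≤ y) (hK : ∀ ω, 2 * y ≤ K ω) (ω : Ω) :
    contFracLim K S ω = (K ω - contFracLim K S (S ω))⁻¹ := by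
  have h1 := (tendsto_add_atTop_iff_nat 1).2 (tendsto_contFrac (S := S) hy hK ω)
  refine tendsto_nhds_unique h1 ((tendsto_const_nhds.sub (tendsto_contFrac hy hK (S ω))).inv₀ ?_)
  have := contFracLim_le (S := S) hy hK (S ω)
  have h2 : y⁻¹ ≤ 1 := inv_le_one_of_one_le₀ hy
  linarith [hK ω]

theorem contFracLim_pos (hy : 1 ≤ y) (hK : ∀ ω, 2 * y ≤ K ω) (ω : Ω) :
    0 < contFracLim K S ω := by
  rw [contFracLim_eq hy hK]
  have := contFracLim_le (S := S) hy hK (S ω)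
  have h2 : y⁻¹ ≤ 1 := inv_le_one_of_one_le₀ hy
  exact inv_pos.2 (by linarith [hK ω])

theorem inv_contFracLim (hy : 1 ≤ y) (hK : ∀ ω, 2 * y ≤ K ω) (ω : Ω) :
    (contFracLim K S ω)⁻¹ = K ω - contFracLim K S (S ω) := by
  rw [contFracLim_eq hy hK, inv_inv]

theorem measurable_contFracLim [MeasurableSpace Ω] (hK : Measurable K) (hS : Measurable S) :
    Measurable (contFracLim K S) := by
  refine Measurable.iSup fun n => ?_
  induction n with
  | zero => exact measurable_const
  | succ n ih => exact (hK.sub (ih.comp hS)).inv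

/-- The continued fraction is a Lipschitz function of `K` in the uniform norm, because the
recursion contracts by the factor `y⁻²`. -/
theorem abs_contFracLim_sub_le {K' : Ω → ℝ} (hy : 1 < y) (hK : ∀ ω, 2 * y ≤ K ω)
    (hK' : ∀ ω, 2 * y ≤ K' ω) {d : ℝ} (hd : ∀ ω, |K ω - K' ω| ≤ d) (ω : Ω) :
    |contFracLim K S ω - contFracLim K' S ω| ≤ d / (y ^ 2 - 1) := by
  have hd0 : 0 ≤ d := (abs_nonneg _).trans (hd ω)
  have hy2 : 0 < y ^ 2 - 1 := by nlinarith
  have key : ∀ n ω, |contFrac K S n ω - contFrac K' S n ω| ≤ d / (y ^ 2 - 1) := by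
    intro n
    induction n with
    | zero => intro ω; simp only [contFrac, sub_self, abs_zero]; positivity
    | succ n ih =>
      intro ω
      have h1 := le_sub_contFrac (S := S) hy.le hK n ω (S ω)
      have h2 := le_sub_contFrac (S := S) hy.le hK' n ω (S ω)
      simp only [contFrac]
      rw [inv_sub_inv (by linarith) (by linarith), abs_div]
      rw [abs_of_pos (a := (K ω - _) * _) (mul_pos (by linarith) (by linarith))]
      have hnum : |K' ω - contFrac K' S n (S ω) - (K ω - contFrac K S n (S ω))| ≤
          d + d / (y ^ 2 - 1) := by
        have e : K' ω - contFrac K' S n (S ω) - (K ω - contFrac K S n (S ω)) =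
            -(K ω - K' ω) + (contFrac K S n (S ω) - contFrac K' S n (S ω)) := by ring
        rw [e]
        refine (abs_add_le _ _).trans (add_le_add ?_ (ih _))
        rw [abs_neg]; exact hd ω
      have hden : y ^ 2 ≤ (K ω - contFrac K S n (S ω)) * (K' ω - contFrac K' S n (S ω)) := by
        rw [sq]; exact mul_le_mul h1 h2 (by linarith) (by linarith)
      calc _ ≤ (d + d / (y ^ 2 - 1)) / y ^ 2 := by
            have : 0 < y := by linarith
            gcongr
        _ = d / (y ^ 2 - 1) := by
            have : y ≠ 0 := by linarith
            field_simp
            ring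
  exact le_of_tendsto' (((tendsto_contFrac hy.le hK ω).sub (tendsto_contFrac hy.le hK' ω)).abs)
    fun n => key n ω

end ContFrac

/-! ### The Lyapunov exponent -/

/-- The coefficient `2 exp (l - β V)` of the equation `u (x + 1) + u (x - 1) = K (x) u (x)`
satisfied by the functions that are multiplied by `exp l` under one step of the weighted walk. -/
def coeff {Ω : Type*} (V : Ω → ℝ) (β l : ℝ) (ω : Ω) : ℝ := 2 * Real.exp (l - β * V ω)

/-- The logarithmic increment at the origin, in the direction opposite to `S`, of the positive
solution `u` that decays in the direction of `S`: with `S` the inverse of the shift this is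
`log (u 1 / u 0)`. -/
def logRatio {Ω : Type*} (S : Ω → Ω) (V : Ω → ℝ) (β l : ℝ) (ω : Ω) : ℝ :=
  -Real.log (contFracLim (coeff V β l) S ω)

/-- The Lyapunov exponent, that is the exponential growth rate of the solution with increments
`logRatio`. -/
def lyapunov {Ω : Type*} [MeasurableSpace Ω] (μ : Measure Ω) (S : Ω → Ω) (V : Ω → ℝ)
    (β l : ℝ) : ℝ :=
  ∫ ω, logRatio S V β l ω ∂μ

theorem abs_exp_sub_exp_le {a b M : ℝ} (ha : a ≤ M) (hb : b ≤ M) :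
    |Real.exp a - Real.exp b| ≤ Real.exp M * |a - b| := by
  wlog h : b ≤ a generalizing a b
  · rw [abs_sub_comm, abs_sub_comm a]; exact this hb ha (le_of_not_ge h)
  rw [abs_of_nonneg (sub_nonneg.2 (Real.exp_le_exp.2 h)), abs_of_nonneg (sub_nonneg.2 h)]
  have h1 : Real.exp b = Real.exp a * Real.exp (b - a) := by rw [← Real.exp_add]; ring_nf
  have h2 := Real.add_one_le_exp (b - a)
  calc Real.exp a - Real.exp b = Real.exp a * (1 - Real.exp (b - a)) := by rw [h1]; ring
    _ ≤ Real.exp M * (a - b) := mul_le_mul (Real.exp_le_exp.2 ha) (by linarith)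
        (by linarith [Real.exp_le_one_iff.2 (sub_nonpos.2 h)]) (Real.exp_pos _).le

theorem abs_log_sub_log_le {a b m : ℝ} (hm : 0 < m) (ha : m ≤ a) (hb : m ≤ b) :
    |Real.log a - Real.log b| ≤ |a - b| / m := by
  wlog h : b ≤ a generalizing a b
  · rw [abs_sub_comm, abs_sub_comm a]; exact this hb ha (le_of_not_ge h)
  have hb0 : 0 < b := by linarith
  have ha0 : 0 < a := by linarith
  rw [abs_of_nonneg (sub_nonneg.2 (Real.log_le_log hb0 h)), abs_of_nonneg (sub_nonneg.2 h),
    ← Real.log_div ha0.ne' hb0.ne']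
  calc Real.log (a / b) ≤ a / b - 1 := Real.log_le_sub_one_of_pos (by positivity)
    _ = (a - b) / b := by field_simp
    _ ≤ (a - b) / m := by gcongr

section Lyapunov

variable {Ω : Type*} {V : Ω → ℝ} {β l l' : ℝ} {S : Ω → Ω}

theorem two_mul_exp_le_coeff (hV : ∀ ω, V ω ∈ Icc (0 : ℝ) 1) (hβ : 0 < β) {l₀ : ℝ} (h : l₀ ≤ l)
    (ω : Ω) : 2 * Real.exp (l₀ - β) ≤ coeff V β l ω := by
  unfold coeff
  gcongr
  nlinarith [(hV ω).2]

theorem coeff_le (hV : ∀ ω, V ω ∈ Icc (0 : ℝ) 1) (hβ : 0 < β) (ω : Ω) :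
    coeff V β l ω ≤ 2 * Real.exp l := by
  unfold coeff
  gcongr
  nlinarith [(hV ω).1]

theorem abs_coeff_sub_le (hV : ∀ ω, V ω ∈ Icc (0 : ℝ) 1) (hβ : 0 < β) {M : ℝ} (h : l ≤ M)
    (h' : l' ≤ M) (ω : Ω) :
    |coeff V β l ω - coeff V β l' ω| ≤ 2 * Real.exp M * |l - l'| := by
  have h0 : 0 ≤ β * V ω := mul_nonneg hβ.le (hV ω).1
  have := abs_exp_sub_exp_le (a := l - β * V ω) (b := l' - β * V ω) (M := M)
    (by linarith) (by linarith)
  unfold coeff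
  rw [← mul_sub, abs_mul, abs_two, mul_assoc]
  rw [sub_sub_sub_cancel_right] at this
  gcongr

theorem one_lt_exp_sub (hl : β < l) : 1 < Real.exp (l - β) := Real.one_lt_exp_iff.2 (by linarith)

theorem exp_logRatio (hV : ∀ ω, V ω ∈ Icc (0 : ℝ) 1) (hβ : 0 < β) (hl : β < l) (ω : Ω) :
    Real.exp (logRatio S V β l ω) = (contFracLim (coeff V β l) S ω)⁻¹ := by
  rw [logRatio, Real.exp_neg, Real.exp_log
    (contFracLim_pos (one_lt_exp_sub hl).le (two_mul_exp_le_coeff hV hβ le_rfl) ω)]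

theorem exp_neg_logRatio (hV : ∀ ω, V ω ∈ Icc (0 : ℝ) 1) (hβ : 0 < β) (hl : β < l) (ω : Ω) :
    Real.exp (-logRatio S V β l ω) = contFracLim (coeff V β l) S ω := by
  rw [Real.exp_neg, exp_logRatio hV hβ hl, inv_inv]

theorem exp_logRatio_add (hV : ∀ ω, V ω ∈ Icc (0 : ℝ) 1) (hβ : 0 < β) (hl : β < l) (ω : Ω) :
    Real.exp (logRatio S V β l ω) + Real.exp (-logRatio S V β l (S ω)) = coeff V β l ω := by
  rw [exp_logRatio hV hβ hl, exp_neg_logRatio hV hβ hl,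
    inv_contFracLim (one_lt_exp_sub hl).le (two_mul_exp_le_coeff hV hβ le_rfl)]
  ring

theorem sub_le_logRatio (hV : ∀ ω, V ω ∈ Icc (0 : ℝ) 1) (hβ : 0 < β) (hl : β < l) (ω : Ω) :
    l - β ≤ logRatio S V β l ω := by
  have h := contFracLim_le (S := S) (one_lt_exp_sub hl).le
    (two_mul_exp_le_coeff hV hβ le_rfl) ω
  rw [← exp_neg_logRatio hV hβ hl, ← Real.exp_neg, Real.exp_le_exp] at h
  linarith

theorem logRatio_le (hV : ∀ ω, V ω ∈ Icc (0 : ℝ) 1) (hβ : 0 < β) (hl : β < l) (ω : Ω) :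
    logRatio S V β l ω ≤ Real.log 2 + l := by
  have h := exp_logRatio_add (S := S) hV hβ hl ω
  have h2 := coeff_le (l := l) hV hβ ω
  have h3 := (Real.exp_pos (-logRatio S V β l (S ω))).le
  rw [← Real.exp_le_exp, Real.exp_add, Real.exp_log two_pos]
  linarith

theorem abs_logRatio_le (hV : ∀ ω, V ω ∈ Icc (0 : ℝ) 1) (hβ : 0 < β) (hl : β < l) (ω : Ω) :
    |logRatio S V β l ω| ≤ Real.log 2 + l := by
  have h := sub_le_logRatio (S := S) hV hβ hl ω
  rw [abs_of_nonneg (by linarith)]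
  exact logRatio_le hV hβ hl ω

variable [MeasurableSpace Ω]

theorem measurable_coeff (hVm : Measurable V) : Measurable (coeff V β l) := by
  unfold coeff; fun_prop

theorem measurable_logRatio (hVm : Measurable V) (hS : Measurable S) :
    Measurable (logRatio S V β l) :=
  (Real.measurable_log.comp (measurable_contFracLim (measurable_coeff hVm) hS)).neg

theorem integrable_logRatio {μ : Measure Ω} [IsFiniteMeasure μ] (hVm : Measurable V)
    (hV : ∀ ω, V ω ∈ Icc (0 : ℝ) 1) (hS : Measurable S) (hβ : 0 < β) (hl : β < l) :
    Integrable (logRatio S V β l) μ :=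
  integrable_of_abs_le (measurable_logRatio hVm hS) (abs_logRatio_le hV hβ hl)

theorem integral_comp_eq {μ : Measure Ω} (hS : MeasurePreserving S μ μ) {f : Ω → ℝ}
    (hf : Measurable f) : ∫ ω, f (S ω) ∂μ = ∫ ω, f ω ∂μ := by
  have := integral_map (μ := μ) hS.measurable.aemeasurable (f := f)
    (by rw [hS.map_eq]; exact hf.aestronglyMeasurable)
  rw [hS.map_eq] at this
  exact this.symm

end Lyapunov

section Wronskian

variable {Ω : Type*} [MeasurableSpace Ω] {V : Ω → ℝ} {β : ℝ} {T : Ω ≃ᵐ Ω}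

/-- The Wronskian of the increasing solution at level `l` and of the decreasing solution at level
`l'`, divided by the product of their values at `0`. It is taken on the edge `{0, 1}` if `m = l`,
and on the edge `{-1, 0}` if `m = l'`. -/
def wronskian (T : Ω ≃ᵐ Ω) (V : Ω → ℝ) (β m l l' : ℝ) (ω : Ω) : ℝ :=
  coeff V β m ω - contFracLim (coeff V β l) T.symm (T.symm ω) -
    contFracLim (coeff V β l') T (T ω)

variable {l₀ m l l' : ℝ}

theorem measurable_wronskian (hVm : Measurable V) : Measurable (wronskian T V β m l l') :=
  ((measurable_coeff hVm).sub ((measurable_contFracLim (measurable_coeff hVm)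
    T.symm.measurable).comp T.symm.measurable)).sub
    ((measurable_contFracLim (measurable_coeff hVm) T.measurable).comp T.measurable)

theorem le_wronskian (hV : ∀ ω, V ω ∈ Icc (0 : ℝ) 1) (hβ : 0 < β) (hm : l₀ ≤ m)
    (hl : β < l) (hl' : β < l') (ω : Ω) :
    2 * (Real.exp (l₀ - β) - 1) ≤ wronskian T V β m l l' ω := by
  have h1 := (contFracLim_le (S := T.symm) (one_lt_exp_sub hl).le
    (two_mul_exp_le_coeff hV hβ le_rfl) (T.symm ω)).trans
    (inv_le_one_of_one_le₀ (one_lt_exp_sub hl).le)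
  have h2 := (contFracLim_le (S := T) (one_lt_exp_sub hl').le
    (two_mul_exp_le_coeff hV hβ le_rfl) (T ω)).trans
    (inv_le_one_of_one_le₀ (one_lt_exp_sub hl').le)
  have h3 := two_mul_exp_le_coeff hV hβ hm ω
  unfold wronskian
  linarith

theorem wronskian_le_coeff (hV : ∀ ω, V ω ∈ Icc (0 : ℝ) 1) (hβ : 0 < β)
    (hl : β < l) (hl' : β < l') (ω : Ω) :
    wronskian T V β m l l' ω ≤ coeff V β m ω := by
  have h1 := contFracLim_pos (S := T.symm) (one_lt_exp_sub hl).le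
    (two_mul_exp_le_coeff hV hβ le_rfl) (T.symm ω)
  have h2 := contFracLim_pos (S := T) (one_lt_exp_sub hl').le
    (two_mul_exp_le_coeff hV hβ le_rfl) (T ω)
  unfold wronskian
  linarith

theorem wronskian_pos (hV : ∀ ω, V ω ∈ Icc (0 : ℝ) 1) (hβ : 0 < β) (hm : β < m)
    (hl : β < l) (hl' : β < l') (ω : Ω) : 0 < wronskian T V β m l l' ω :=
  lt_of_lt_of_le (by linarith [one_lt_exp_sub hm]) (le_wronskian hV hβ le_rfl hl hl' ω)

theorem integrable_log_wronskian {μ : Measure Ω} [IsFiniteMeasure μ] (hVm : Measurable V)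
    (hV : ∀ ω, V ω ∈ Icc (0 : ℝ) 1) (hβ : 0 < β) (hm : β < m) (hl : β < l) (hl' : β < l') :
    Integrable (fun ω => Real.log (wronskian T V β m l l' ω)) μ := by
  have h0 : 0 < 2 * (Real.exp (m - β) - 1) := by linarith [one_lt_exp_sub hm]
  refine integrable_of_abs_le (Real.measurable_log.comp (measurable_wronskian hVm))
    (C := |Real.log (2 * (Real.exp (m - β) - 1))| + |Real.log (2 * Real.exp m)|) fun ω => ?_
  have h1 := le_wronskian (T := T) (l₀ := m) hV hβ le_rfl hl hl' ω
  have h2 := (wronskian_le_coeff (T := T) (m := m) hV hβ hl hl' ω).trans (coeff_le hV hβ ω)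
  have h3 := Real.log_le_log h0 h1
  have h4 := Real.log_le_log (h0.trans_le h1) h2
  rw [abs_le]
  constructor
  · linarith [neg_abs_le (Real.log (2 * (Real.exp (m - β) - 1))),
      abs_nonneg (Real.log (2 * Real.exp m))]
  · linarith [le_abs_self (Real.log (2 * Real.exp m)),
      abs_nonneg (Real.log (2 * (Real.exp (m - β) - 1)))]

/-- The growth rates of the increasing solution at level `l` and of the decreasing solution at
level `l'` differ by the mean logarithmic increment of their Wronskian: seen from `x` and from
`x + 1`, the normalised Wronskians are `(1 - g h) / g` and `(1 - g h) / h`. -/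
theorem lyapunov_sub_lyapunov {μ : Measure Ω} [IsFiniteMeasure μ] (hT : MeasurePreserving T μ μ)
    (hVm : Measurable V) (hV : ∀ ω, V ω ∈ Icc (0 : ℝ) 1) (hβ : 0 < β) (hl : β < l)
    (hl' : β < l') :
    lyapunov μ T.symm V β l - lyapunov μ T V β l' =
      ∫ ω, (Real.log (wronskian T V β l l l' ω) - Real.log (wronskian T V β l' l l' ω)) ∂μ := by
  have hpt : ∀ ω, Real.log (wronskian T V β l l l' ω) - logRatio T.symm V β l ω =
      Real.log (wronskian T V β l' l l' (T ω)) - logRatio T V β l' (T ω) := by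
    intro ω
    have hg := contFracLim_pos (S := T.symm) (one_lt_exp_sub hl).le
      (two_mul_exp_le_coeff hV hβ le_rfl) ω
    have hh := contFracLim_pos (S := T) (one_lt_exp_sub hl').le
      (two_mul_exp_le_coeff hV hβ le_rfl) (T ω)
    have hW := wronskian_pos (T := T) hV hβ hl hl hl' ω
    have hW' := wronskian_pos (T := T) hV hβ hl' hl hl' (T ω)
    rw [logRatio, logRatio, sub_neg_eq_add, sub_neg_eq_add, ← Real.log_mul hW.ne' hg.ne',
      ← Real.log_mul hW'.ne' hh.ne']
    congr 1
    have e1 := inv_contFracLim (S := T.symm) (one_lt_exp_sub hl).le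
      (two_mul_exp_le_coeff hV hβ le_rfl) ω
    have e2 := inv_contFracLim (S := T) (one_lt_exp_sub hl').le
      (two_mul_exp_le_coeff hV hβ le_rfl) (T ω)
    have e3 : wronskian T V β l l l' ω = (contFracLim (coeff V β l) T.symm ω)⁻¹ -
        contFracLim (coeff V β l') T (T ω) := by rw [e1]; rfl
    have e4 : wronskian T V β l' l l' (T ω) = (contFracLim (coeff V β l') T (T ω))⁻¹ -
        contFracLim (coeff V β l) T.symm ω := by
      rw [e2, wronskian, T.symm_apply_apply]; ring
    rw [e3, e4]
    field_simp
  have i1 := integrable_log_wronskian (μ := μ) (T := T) hVm hV hβ hl hl hl'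
  have i2 := integrable_log_wronskian (μ := μ) (T := T) hVm hV hβ hl' hl hl'
  have j1 := integrable_logRatio (μ := μ) hVm hV T.symm.measurable hβ hl
  have j2 := integrable_logRatio (μ := μ) hVm hV T.measurable hβ hl'
  have hmeas : Measurable fun ω => Real.log (wronskian T V β l' l l' ω) - logRatio T V β l' ω :=
    (Real.measurable_log.comp (measurable_wronskian hVm)).sub
      (measurable_logRatio hVm T.measurable)
  have h := integral_congr_ae (μ := μ) (ae_of_all _ hpt)
  rw [integral_comp_eq hT hmeas, integral_sub i1 j1, integral_sub i2 j2] at h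
  rw [integral_sub i1 i2, lyapunov, lyapunov]
  linarith

/-- Left and right solutions grow at the same rate. -/
theorem lyapunov_symm {μ : Measure Ω} [IsFiniteMeasure μ] (hT : MeasurePreserving T μ μ)
    (hVm : Measurable V) (hV : ∀ ω, V ω ∈ Icc (0 : ℝ) 1) (hβ : 0 < β) (hl : β < l) :
    lyapunov μ T.symm V β l = lyapunov μ T V β l := by
  have h := lyapunov_sub_lyapunov (μ := μ) hT hVm hV hβ hl hl
  simp only [sub_self, integral_zero] at h
  linarith

end Wronskian

/-! ### Differentiability of the Lyapunov exponent -/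

/-- The derivative of the Lyapunov exponent in the level `l`. -/
def lyapunovDeriv {Ω : Type*} [MeasurableSpace Ω] (μ : Measure Ω) (T : Ω ≃ᵐ Ω) (V : Ω → ℝ)
    (β l : ℝ) : ℝ :=
  ∫ ω, coeff V β l ω / wronskian T V β l l l ω ∂μ

section Derivative

variable {Ω : Type*} {V : Ω → ℝ} {β l₀ : ℝ}

theorem eventually_level_mem (hl : β < l₀) :
    ∀ᶠ l in 𝓝 l₀, (β + l₀) / 2 ≤ l ∧ l ≤ l₀ + 1 := by
  filter_upwards [Icc_mem_nhds (show (β + l₀) / 2 < l₀ by linarith)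
    (show l₀ < l₀ + 1 by linarith)] with l hl
  exact hl

theorem continuousAt_contFracLim {S : Ω → Ω} (hV : ∀ ω, V ω ∈ Icc (0 : ℝ) 1) (hβ : 0 < β)
    (hl : β < l₀) (ω : Ω) : ContinuousAt (fun l => contFracLim (coeff V β l) S ω) l₀ := by
  have hy : 1 < Real.exp ((β + l₀) / 2 - β) := one_lt_exp_sub (by linarith)
  refine tendsto_iff_norm_sub_tendsto_zero.2 ?_
  have h0 : Tendsto (fun l => 2 * Real.exp (l₀ + 1) * |l - l₀| /
      (Real.exp ((β + l₀) / 2 - β) ^ 2 - 1)) (𝓝 l₀) (𝓝 0) := by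
    have : Continuous fun l => 2 * Real.exp (l₀ + 1) * |l - l₀| /
      (Real.exp ((β + l₀) / 2 - β) ^ 2 - 1) := by fun_prop
    simpa using this.tendsto l₀
  refine squeeze_zero' (Eventually.of_forall fun l => norm_nonneg _) ?_ h0
  filter_upwards [eventually_level_mem hl] with l h
  exact abs_contFracLim_sub_le hy (two_mul_exp_le_coeff hV hβ h.1)
    (two_mul_exp_le_coeff hV hβ (by linarith))
    (abs_coeff_sub_le hV hβ h.2 (by linarith)) ω

theorem continuous_coeff (V : Ω → ℝ) (β : ℝ) (ω : Ω) : Continuous fun l => coeff V β l ω := by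
  unfold coeff; fun_prop

theorem hasDerivAt_coeff (V : Ω → ℝ) (β l : ℝ) (ω : Ω) :
    HasDerivAt (fun l => coeff V β l ω) (coeff V β l ω) l :=
  ((((hasDerivAt_id l).sub_const (β * V ω)).exp).const_mul 2).congr_deriv (by simp [coeff])

/-- Strict differentiability of the logarithm, along two families with a common limit. -/
theorem tendsto_inv_mul_log_sub_log {A B : ℝ → ℝ} {x D d : ℝ} (hD : 0 < D)
    (hA : Tendsto A (𝓝[≠] x) (𝓝 D)) (hB : Tendsto B (𝓝[≠] x) (𝓝 D))
    (hd : Tendsto (fun t => (t - x)⁻¹ * (A t - B t)) (𝓝[≠] x) (𝓝 d)) :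
    Tendsto (fun t => (t - x)⁻¹ * (Real.log (A t) - Real.log (B t))) (𝓝[≠] x) (𝓝 (d / D)) := by
  have h1 := (Real.hasStrictDerivAt_log hD.ne').isLittleO.comp_tendsto (hA.prodMk_nhds hB)
  have h2 := ((Asymptotics.isBigO_refl (fun t => (t - x)⁻¹) (𝓝[≠] x)).mul_isLittleO h1).trans_isBigO
    (hd.isBigO_one ℝ)
  have h3 := ((Asymptotics.isLittleO_one_iff ℝ).1 h2).add (hd.div_const D)
  rw [zero_add] at h3
  refine h3.congr fun t => ?_
  simp only [Function.comp_apply, ContinuousLinearMap.toSpanSingleton_apply, smul_eq_mul]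
  ring

variable [MeasurableSpace Ω] {T : Ω ≃ᵐ Ω}

theorem continuousAt_wronskian (hV : ∀ ω, V ω ∈ Icc (0 : ℝ) 1) (hβ : 0 < β)
    (hl : β < l₀) (ω : Ω) : ContinuousAt (fun l => wronskian T V β l l l ω) l₀ :=
  ((continuous_coeff V β ω).continuousAt.sub (continuousAt_contFracLim hV hβ hl _)).sub
    (continuousAt_contFracLim hV hβ hl _)

/-- The dominated convergence theorem applies to the difference quotients given by
`lyapunov_sub_lyapunov`. -/
theorem hasDerivAt_lyapunov {μ : Measure Ω} [IsFiniteMeasure μ] (hT : MeasurePreserving T μ μ)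
    (hVm : Measurable V) (hV : ∀ ω, V ω ∈ Icc (0 : ℝ) 1) (hβ : 0 < β) (hl : β < l₀) :
    HasDerivAt (fun l => lyapunov μ T.symm V β l) (lyapunovDeriv μ T V β l₀) l₀ := by
  have hl1 : β < (β + l₀) / 2 := by linarith
  set c : ℝ := 2 * (Real.exp ((β + l₀) / 2 - β) - 1) with hc
  have hc0 : 0 < c := by linarith [one_lt_exp_sub hl1]
  have hlow : ∀ {m l : ℝ}, (β + l₀) / 2 ≤ m → β < l → ∀ ω, c ≤ wronskian T V β m l l₀ ω :=
    fun hm hl' ω => le_wronskian hV hβ hm hl' hl ω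
  have hev : ∀ᶠ l in 𝓝[≠] l₀, (β + l₀) / 2 ≤ l ∧ l ≤ l₀ + 1 :=
    (eventually_level_mem hl).filter_mono nhdsWithin_le_nhds
  rw [hasDerivAt_iff_tendsto_slope]
  have hslope : ∀ᶠ l in 𝓝[≠] l₀, ∫ ω, (l - l₀)⁻¹ * (Real.log (wronskian T V β l l l₀ ω) -
      Real.log (wronskian T V β l₀ l l₀ ω)) ∂μ = slope (fun l => lyapunov μ T.symm V β l) l₀ l := by
    filter_upwards [hev] with l h
    rw [integral_const_mul, ← lyapunov_sub_lyapunov hT hVm hV hβ (hl1.trans_le h.1) hl,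
      ← lyapunov_symm hT hVm hV hβ hl]
    rfl
  refine Tendsto.congr' hslope ?_
  refine tendsto_integral_filter_of_dominated_convergence
    (fun _ => 2 * Real.exp (l₀ + 1) / c) ?_ ?_ (integrable_const _) ?_
  · exact Eventually.of_forall fun l => (((Real.measurable_log.comp (measurable_wronskian hVm)).sub
      (Real.measurable_log.comp (measurable_wronskian hVm))).const_mul _).aestronglyMeasurable
  · filter_upwards [hev, self_mem_nhdsWithin] with l h hne
    refine ae_of_all _ fun ω => ?_
    have hne' : 0 < |l - l₀| := abs_pos.2 (sub_ne_zero.2 hne)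
    have h1 := abs_log_sub_log_le hc0 (hlow h.1 (hl1.trans_le h.1) ω)
      (hlow (m := l₀) (by linarith) (hl1.trans_le h.1) ω)
    have h2 := abs_coeff_sub_le (V := V) hV hβ h.2 (show l₀ ≤ l₀ + 1 by linarith) ω
    have e : wronskian T V β l l l₀ ω - wronskian T V β l₀ l l₀ ω =
        coeff V β l ω - coeff V β l₀ ω := by unfold wronskian; ring
    rw [e] at h1
    rw [Real.norm_eq_abs, abs_mul, abs_inv]
    calc _ ≤ |l - l₀|⁻¹ * (2 * Real.exp (l₀ + 1) * |l - l₀| / c) := by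
          gcongr
          exact h1.trans (by gcongr)
      _ = 2 * Real.exp (l₀ + 1) / c := by field_simp
  · refine ae_of_all _ fun ω => ?_
    have hA : ContinuousAt (fun l => wronskian T V β l l l₀ ω) l₀ :=
      ((continuous_coeff V β ω).continuousAt.sub (continuousAt_contFracLim hV hβ hl _)).sub
        continuousAt_const
    have hB : ContinuousAt (fun l => wronskian T V β l₀ l l₀ ω) l₀ :=
      (continuousAt_const.sub (continuousAt_contFracLim hV hβ hl _)).sub continuousAt_const
    refine tendsto_inv_mul_log_sub_log (wronskian_pos hV hβ hl hl hl ω)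
      (hA.tendsto.mono_left nhdsWithin_le_nhds) (hB.tendsto.mono_left nhdsWithin_le_nhds) ?_
    have hd := hasDerivAt_iff_tendsto_slope.1 (hasDerivAt_coeff V β l₀ ω)
    refine hd.congr fun l => ?_
    have e : wronskian T V β l l l₀ ω - wronskian T V β l₀ l l₀ ω =
        coeff V β l ω - coeff V β l₀ ω := by unfold wronskian; ring
    rw [e]
    rfl

theorem one_le_coeff_div_wronskian (hV : ∀ ω, V ω ∈ Icc (0 : ℝ) 1) (hβ : 0 < β) {l : ℝ}
    (hl : β < l) (ω : Ω) : 1 ≤ coeff V β l ω / wronskian T V β l l l ω :=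
  (one_le_div (wronskian_pos hV hβ hl hl hl ω)).2 (wronskian_le_coeff hV hβ hl hl ω)

theorem coeff_div_wronskian_le (hV : ∀ ω, V ω ∈ Icc (0 : ℝ) 1) (hβ : 0 < β) {l l₁ M : ℝ}
    (hl₁ : β < l₁) (hl : l₁ ≤ l) (hM : l ≤ M) (ω : Ω) :
    coeff V β l ω / wronskian T V β l l l ω ≤
      2 * Real.exp M / (2 * (Real.exp (l₁ - β) - 1)) := by
  have h1 := le_wronskian (T := T) hV hβ hl (hl₁.trans_le hl) (hl₁.trans_le hl) ω
  have h2 := coeff_le (l := l) hV hβ ω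
  have h3 : 0 < 2 * (Real.exp (l₁ - β) - 1) := by linarith [one_lt_exp_sub hl₁]
  have h4 := Real.exp_le_exp.2 hM
  exact div_le_div₀ (by positivity) (by linarith) h3 h1

theorem measurable_coeff_div_wronskian (hVm : Measurable V) (l : ℝ) :
    Measurable fun ω => coeff V β l ω / wronskian T V β l l l ω :=
  (measurable_coeff hVm).div (measurable_wronskian hVm)

theorem one_le_lyapunovDeriv {μ : Measure Ω} [IsProbabilityMeasure μ] (hVm : Measurable V)
    (hV : ∀ ω, V ω ∈ Icc (0 : ℝ) 1) (hβ : 0 < β) {l : ℝ} (hl : β < l) :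
    1 ≤ lyapunovDeriv μ T V β l := by
  have hint : Integrable (fun ω => coeff V β l ω / wronskian T V β l l l ω) μ :=
    integrable_of_abs_le (measurable_coeff_div_wronskian hVm l) fun ω => by
      rw [abs_of_nonneg (zero_le_one.trans (one_le_coeff_div_wronskian hV hβ hl ω))]
      exact coeff_div_wronskian_le hV hβ hl le_rfl le_rfl ω
  have h := integral_mono (μ := μ) (integrable_const (1 : ℝ)) hint
    (one_le_coeff_div_wronskian hV hβ hl)
  simpa [lyapunovDeriv] using h

theorem continuousAt_lyapunovDeriv {μ : Measure Ω} [IsFiniteMeasure μ] (hVm : Measurable V)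
    (hV : ∀ ω, V ω ∈ Icc (0 : ℝ) 1) (hβ : 0 < β) (hl : β < l₀) :
    ContinuousAt (fun l => lyapunovDeriv μ T V β l) l₀ := by
  have hl1 : β < (β + l₀) / 2 := by linarith
  refine tendsto_integral_filter_of_dominated_convergence
    (fun _ => 2 * Real.exp (l₀ + 1) / (2 * (Real.exp ((β + l₀) / 2 - β) - 1)))
    (Eventually.of_forall fun l => (measurable_coeff_div_wronskian hVm l).aestronglyMeasurable)
    ?_ (integrable_const _) ?_
  · filter_upwards [eventually_level_mem hl] with l h
    refine ae_of_all _ fun ω => ?_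
    rw [Real.norm_eq_abs, abs_of_nonneg
      (zero_le_one.trans (one_le_coeff_div_wronskian hV hβ (hl1.trans_le h.1) ω))]
    exact coeff_div_wronskian_le hV hβ hl1 h.1 h.2 ω
  · exact ae_of_all _ fun ω => ((continuous_coeff V β ω).continuousAt.div
      (continuousAt_wronskian hV hβ hl ω) (wronskian_pos hV hβ hl hl hl ω).ne').tendsto

end Derivative

/-! ### Bounds on the Lyapunov exponent -/

section Bounds

variable {Ω : Type*} {V : Ω → ℝ} {β l : ℝ} {S : Ω → Ω}

/-- Half the sum of the logarithmic increments of the solution at two neighbouring sites. -/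
def meanRatio {Ω : Type*} (S : Ω → Ω) (V : Ω → ℝ) (β l : ℝ) (ω : Ω) : ℝ :=
  (logRatio S V β l ω + logRatio S V β l (S ω)) / 2

theorem sub_le_meanRatio (hV : ∀ ω, V ω ∈ Icc (0 : ℝ) 1) (hβ : 0 < β) (hl : β < l) (ω : Ω) :
    l - β ≤ meanRatio S V β l ω := by
  have h1 := sub_le_logRatio (S := S) hV hβ hl ω
  have h2 := sub_le_logRatio (S := S) hV hβ hl (S ω)
  unfold meanRatio; linarith

theorem abs_meanRatio_le (hV : ∀ ω, V ω ∈ Icc (0 : ℝ) 1) (hβ : 0 < β) (hl : β < l) (ω : Ω) :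
    |meanRatio S V β l ω| ≤ Real.log 2 + l := by
  rw [abs_of_nonneg (by linarith [sub_le_meanRatio (S := S) hV hβ hl ω])]
  have h1 := logRatio_le (S := S) hV hβ hl ω
  have h2 := logRatio_le (S := S) hV hβ hl (S ω)
  unfold meanRatio; linarith

variable [MeasurableSpace Ω]

theorem measurable_meanRatio (hVm : Measurable V) (hS : Measurable S) :
    Measurable (meanRatio S V β l) :=
  ((measurable_logRatio hVm hS).add ((measurable_logRatio hVm hS).comp hS)).div_const 2

variable {μ : Measure Ω} [IsProbabilityMeasure μ]

theorem sub_le_lyapunov (hVm : Measurable V)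
    (hV : ∀ ω, V ω ∈ Icc (0 : ℝ) 1) (hS : Measurable S) (hβ : 0 < β) (hl : β < l) :
    l - β ≤ lyapunov μ S V β l := by
  have h := integral_mono (μ := μ) (integrable_const (l - β))
    (integrable_logRatio (S := S) hVm hV hS hβ hl) (sub_le_logRatio hV hβ hl)
  simpa [lyapunov] using h

theorem integral_meanRatio (hS : MeasurePreserving S μ μ) (hVm : Measurable V)
    (hV : ∀ ω, V ω ∈ Icc (0 : ℝ) 1) (hβ : 0 < β) (hl : β < l) :
    ∫ ω, meanRatio S V β l ω ∂μ = lyapunov μ S V β l := by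
  have i1 := integrable_logRatio (μ := μ) (S := S) hVm hV hS.measurable hβ hl
  have i2 : Integrable (fun ω => logRatio S V β l (S ω)) μ := hS.integrable_comp_of_integrable i1
  simp only [meanRatio]
  rw [integral_div, integral_add i1 i2,
    integral_comp_eq hS (measurable_logRatio hVm hS.measurable), lyapunov]
  ring

theorem integrable_log_cosh_meanRatio (hS : Measurable S) (hVm : Measurable V)
    (hV : ∀ ω, V ω ∈ Icc (0 : ℝ) 1) (hβ : 0 < β) (hl : β < l) :
    Integrable (fun ω => Real.log (Real.cosh (meanRatio S V β l ω))) μ := by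
  refine integrable_of_abs_le (Real.measurable_log.comp
    (Real.measurable_cosh.comp (measurable_meanRatio hVm hS))) (C := Real.log 2 + l) fun ω => ?_
  rw [abs_of_nonneg (Real.log_nonneg (Real.one_le_cosh _))]
  exact (log_cosh_le_abs _).trans (abs_meanRatio_le hV hβ hl ω)

/-- The logarithm of `exp (l - β V) = (exp p + exp (-p ∘ S)) / 2`, with `p` the logarithmic
increment of the solution, is `(p - p ∘ S) / 2 + log cosh ((p + p ∘ S) / 2)`, and the first term
has mean zero. -/
theorem integral_log_cosh_meanRatio (hS : MeasurePreserving S μ μ) (hVm : Measurable V)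
    (hV : ∀ ω, V ω ∈ Icc (0 : ℝ) 1) (hβ : 0 < β) (hl : β < l) :
    ∫ ω, Real.log (Real.cosh (meanRatio S V β l ω)) ∂μ = l - β * ∫ ω, V ω ∂μ := by
  have i1 := integrable_logRatio (μ := μ) (S := S) hVm hV hS.measurable hβ hl
  have i2 : Integrable (fun ω => logRatio S V β l (S ω)) μ := hS.integrable_comp_of_integrable i1
  have iV : Integrable V μ := integrable_of_abs_le hVm (C := 1) fun ω => by
    rw [abs_of_nonneg (hV ω).1]; exact (hV ω).2
  have hpt : ∀ ω, Real.log (Real.cosh (meanRatio S V β l ω)) =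
      (l - β * V ω) - (logRatio S V β l ω - logRatio S V β l (S ω)) / 2 := by
    intro ω
    have h := exp_logRatio_add (S := S) hV hβ hl ω
    have e : Real.exp (l - β * V ω) =
        Real.exp ((logRatio S V β l ω - logRatio S V β l (S ω)) / 2) *
          Real.cosh (meanRatio S V β l ω) := by
      have e0 : Real.exp (l - β * V ω) = coeff V β l ω / 2 := by unfold coeff; ring
      rw [e0, ← h, Real.cosh_eq, mul_div_assoc', mul_add, ← Real.exp_add, ← Real.exp_add]
      unfold meanRatio
      ring_nf
    have h2 := congrArg Real.log e
    rw [Real.log_exp, Real.log_mul (Real.exp_pos _).ne' (Real.cosh_pos _).ne',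
      Real.log_exp] at h2
    linarith
  have i3 : Integrable (fun ω => l - β * V ω) μ := (integrable_const l).sub (iV.const_mul β)
  have i4 : Integrable (fun ω => (logRatio S V β l ω - logRatio S V β l (S ω)) / 2) μ :=
    (i1.sub i2).div_const 2
  rw [integral_congr_ae (ae_of_all _ hpt), integral_sub i3 i4, integral_div, integral_sub i1 i2,
    integral_comp_eq hS (measurable_logRatio hVm hS.measurable), integral_sub (integrable_const l)
    (iV.const_mul β), integral_const_mul]
  simp

theorem log_cosh_lyapunov_le (hS : MeasurePreserving S μ μ) (hVm : Measurable V)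
    (hV : ∀ ω, V ω ∈ Icc (0 : ℝ) 1) (hβ : 0 < β) (hl : β < l) :
    Real.log (Real.cosh (lyapunov μ S V β l)) ≤ l - β * ∫ ω, V ω ∂μ := by
  rw [← integral_log_cosh_meanRatio hS hVm hV hβ hl, ← integral_meanRatio hS hVm hV hβ hl]
  have hcont : Continuous fun t => Real.log (Real.cosh t) :=
    Real.continuous_cosh.log fun t => (Real.cosh_pos t).ne'
  exact convexOn_log_cosh.map_integral_le hcont.continuousOn isClosed_univ
    (ae_of_all _ fun _ => mem_univ _)
    (integrable_of_abs_le (measurable_meanRatio hVm hS.measurable) (abs_meanRatio_le hV hβ hl))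
    (integrable_log_cosh_meanRatio hS.measurable hVm hV hβ hl)

theorem sub_mul_integral_le_lyapunov (hS : MeasurePreserving S μ μ) (hVm : Measurable V)
    (hV : ∀ ω, V ω ∈ Icc (0 : ℝ) 1) (hβ : 0 < β) (hl : β < l) :
    l - β * ∫ ω, V ω ∂μ ≤ lyapunov μ S V β l := by
  rw [← integral_log_cosh_meanRatio hS hVm hV hβ hl, ← integral_meanRatio hS hVm hV hβ hl]
  refine integral_mono (integrable_log_cosh_meanRatio hS.measurable hVm hV hβ hl)
    (integrable_of_abs_le (measurable_meanRatio hVm hS.measurable) (abs_meanRatio_le hV hβ hl))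
    fun ω => (log_cosh_le_abs _).trans (abs_of_nonneg ?_).le
  linarith [sub_le_meanRatio (S := S) hV hβ hl ω]

/-- At high levels `log cosh t` is `t - log 2` up to an exponentially small error, uniformly over
the range of the increments. -/
theorem sub_mul_integral_le_log_cosh_add (hS : MeasurePreserving S μ μ) (hVm : Measurable V)
    (hV : ∀ ω, V ω ∈ Icc (0 : ℝ) 1) (hβ : 0 < β) (hl : β < l) :
    l - β * ∫ ω, V ω ∂μ ≤
      Real.log (Real.cosh (lyapunov μ S V β l)) + Real.exp (-(2 * (l - β))) := by
  have i1 : Integrable (meanRatio S V β l) μ :=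
    integrable_of_abs_le (measurable_meanRatio hVm hS.measurable) (abs_meanRatio_le hV hβ hl)
  have h := integral_mono (μ := μ) (integrable_log_cosh_meanRatio hS.measurable hVm hV hβ hl)
    (i1.add (integrable_const (-Real.log 2 + Real.exp (-(2 * (l - β)))))) fun ω => by
      have h1 := log_cosh_le_sub_log_two_add (meanRatio S V β l ω)
      have h2 : Real.exp (-(2 * meanRatio S V β l ω)) ≤ Real.exp (-(2 * (l - β))) :=
        Real.exp_le_exp.2 (by linarith [sub_le_meanRatio (S := S) hV hβ hl ω])
      show _ ≤ meanRatio S V β l ω + (-Real.log 2 + Real.exp (-(2 * (l - β))))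
      linarith
  simp only [Pi.add_apply] at h
  rw [integral_log_cosh_meanRatio hS hVm hV hβ hl, integral_add i1 (integrable_const _),
    integral_meanRatio hS hVm hV hβ hl] at h
  have h2 := sub_log_two_le_log_cosh (lyapunov μ S V β l)
  simp only [integral_const, probReal_univ, smul_eq_mul, one_mul] at h
  linarith

end Bounds

/-! ### The transfer operator of the weighted walk -/

/-- One step of the simple random walk on `ℤ`, weighted by the exponential of the potential `v` at
the starting point. -/
def transfer (v f : ℤ → ℝ) (x : ℤ) : ℝ := Real.exp (v x) * ((f (x + 1) + f (x - 1)) / 2)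

section Transfer

variable {v f f' : ℤ → ℝ}

theorem transfer_mono (h : ∀ x, f x ≤ f' x) (x : ℤ) : transfer v f x ≤ transfer v f' x := by
  unfold transfer
  have h1 := h (x + 1)
  have h2 := h (x - 1)
  gcongr

theorem transfer_const_mul (c : ℝ) (f : ℤ → ℝ) (x : ℤ) :
    transfer v (fun y => c * f y) x = c * transfer v f x := by
  unfold transfer; ring

theorem iterate_transfer_mono (h : ∀ x, f x ≤ f' x) (n : ℕ) (x : ℤ) :
    (transfer v)^[n] f x ≤ (transfer v)^[n] f' x := by
  induction n generalizing f f' with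
  | zero => exact h x
  | succ n ih =>
    rw [Function.iterate_succ_apply, Function.iterate_succ_apply]
    exact ih (transfer_mono h)

theorem iterate_transfer_const_mul (c : ℝ) (f : ℤ → ℝ) (n : ℕ) (x : ℤ) :
    (transfer v)^[n] (fun y => c * f y) x = c * (transfer v)^[n] f x := by
  induction n generalizing f with
  | zero => rfl
  | succ n ih =>
    rw [Function.iterate_succ_apply, Function.iterate_succ_apply, ← ih]
    exact congrArg (fun g => (transfer v)^[n] g x) (funext (transfer_const_mul c f))

theorem pow_mul_le_iterate_transfer {c : ℝ} (hc : 0 ≤ c) (h : ∀ x, c * f x ≤ transfer v f x)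
    (n : ℕ) (x : ℤ) : c ^ n * f x ≤ (transfer v)^[n] f x := by
  induction n generalizing x with
  | zero => simp
  | succ n ih =>
    rw [Function.iterate_succ_apply]
    refine le_trans ?_ (iterate_transfer_mono h n x)
    rw [iterate_transfer_const_mul, pow_succ', mul_assoc]
    exact mul_le_mul_of_nonneg_left (ih x) hc

theorem iterate_transfer_le_pow_mul {c : ℝ} (hc : 0 ≤ c) (h : ∀ x, transfer v f x ≤ c * f x)
    (n : ℕ) (x : ℤ) : (transfer v)^[n] f x ≤ c ^ n * f x := by
  induction n generalizing x with
  | zero => simp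
  | succ n ih =>
    rw [Function.iterate_succ_apply]
    refine (iterate_transfer_mono h n x).trans ?_
    rw [iterate_transfer_const_mul, pow_succ', mul_assoc]
    exact mul_le_mul_of_nonneg_left (ih x) hc

theorem transfer_exp (v : ℤ → ℝ) (θ : ℝ) (x : ℤ) :
    transfer v (fun y => Real.exp (θ * y)) x =
      Real.exp (v x) * Real.cosh θ * Real.exp (θ * x) := by
  unfold transfer
  push_cast
  rw [Real.cosh_eq, mul_add, mul_sub, Real.exp_add, mul_one, sub_eq_add_neg, Real.exp_add]
  ring

end Transfer

/-! ### The partition function as an iterate of the transfer operator -/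

theorem walkExp_mono {n : ℕ} {F G : (Fin n → ℤˣ) → ℝ} (h : ∀ z, F z ≤ G z) :
    walkExp n F ≤ walkExp n G :=
  Finset.sum_le_sum fun z _ => mul_le_mul_of_nonneg_left (h z)
    (Finset.prod_nonneg fun _ _ => by norm_num)

theorem walkExp_const_mul {n : ℕ} (c : ℝ) (F : (Fin n → ℤˣ) → ℝ) :
    walkExp n (fun z => c * F z) = c * walkExp n F := by
  unfold walkExp
  rw [Finset.mul_sum]
  exact Finset.sum_congr rfl fun z _ => by ring

theorem walkExp_succ (n : ℕ) (F : (Fin (n + 1) → ℤˣ) → ℝ) :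
    walkExp (n + 1) F =
      (walkExp n (fun z => F (Fin.cons 1 z)) + walkExp n fun z => F (Fin.cons (-1) z)) / 2 := by
  have e : ∀ s z, Fin.consEquiv (fun _ : Fin (n + 1) => ℤˣ) (s, z) = Fin.cons s z :=
    fun _ _ => rfl
  unfold walkExp
  rw [← (Fin.consEquiv fun _ : Fin (n + 1) => ℤˣ).sum_comp, Fintype.sum_prod_type,
    Fintype.sum_eq_add (1 : ℤˣ) (-1) (by decide)
      (fun x hx => absurd (Int.units_eq_one_or x) (by tauto)), add_div]
  congr 1 <;>
  · rw [Finset.sum_div]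
    refine Finset.sum_congr rfl fun z _ => ?_
    rw [Fin.prod_univ_succ]
    rw [e]
    ring

theorem pos_zero {n : ℕ} (z : Fin n → ℤˣ) : pos z 0 = 0 := by simp [pos]

theorem pos_cons_succ {n : ℕ} (s : ℤˣ) (z : Fin n → ℤˣ) (i : ℕ) :
    pos (Fin.cons s z : Fin (n + 1) → ℤˣ) (i + 1) = s + pos z i := by
  simp [pos, Fin.sum_univ_succ]

theorem pos_neg {n : ℕ} (z : Fin n → ℤˣ) (i : ℕ) : pos (-z) i = -pos z i := by
  unfold pos
  rw [← Finset.sum_neg_distrib]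
  refine Finset.sum_congr rfl fun j _ => ?_
  split_ifs <;> simp

theorem abs_pos_le {n : ℕ} (z : Fin n → ℤˣ) (i : ℕ) : |pos z i| ≤ n := by
  unfold pos
  refine (Finset.abs_sum_le_sum_abs _ _).trans ?_
  refine (Finset.sum_le_sum (g := fun _ => (1 : ℤ)) fun j _ => ?_).trans (by simp)
  split_ifs
  · rcases Int.units_eq_one_or (z j) with h | h <;> simp [h]
  · simp

theorem walkExp_eq_iterate_transfer (v f : ℤ → ℝ) (n : ℕ) (x : ℤ) :
    walkExp n (fun z => Real.exp (∑ i ∈ Finset.range n, v (x + pos z i)) * f (x + pos z n)) =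
      (transfer v)^[n] f x := by
  induction n generalizing x with
  | zero => simp [walkExp, pos_zero]
  | succ n ih =>
    rw [walkExp_succ, Function.iterate_succ_apply', transfer, ← ih, ← ih]
    simp only [Finset.sum_range_succ', pos_cons_succ, pos_zero, add_zero, Real.exp_add,
      Units.val_one, Units.val_neg, ← add_assoc, ← sub_eq_add_neg]
    rw [mul_div_assoc', mul_add, ← walkExp_const_mul, ← walkExp_const_mul]
    congr 3 <;> funext z <;> ring_nf

section Partition

variable {Ω : Type*} [MeasurableSpace Ω] (T : Ω ≃ᵐ Ω) (V : Ω → ℝ) (β θ : ℝ) (n : ℕ) (ω : Ω)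

theorem partitionFn_eq_walkExp : partitionFn T V β θ n ω = walkExp n fun z =>
    Real.exp (∑ i ∈ Finset.range n, β * V (shift T (pos z i) ω)) * Real.exp (θ * pos z n) := by
  unfold partitionFn
  simp only [Real.exp_add, Finset.mul_sum]

theorem partitionFn_eq_iterate : partitionFn T V β θ n ω =
    (transfer fun x => β * V (shift T x ω))^[n] (fun x => Real.exp (θ * x)) 0 := by
  rw [partitionFn_eq_walkExp, ← walkExp_eq_iterate_transfer]
  simp only [zero_add]

theorem partitionFn_pos : 0 < partitionFn T V β θ n ω :=
  Finset.sum_pos (fun z _ => mul_pos (Finset.prod_pos fun _ _ => by norm_num) (Real.exp_pos _))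
    Finset.univ_nonempty

theorem partitionFn_zero_left : partitionFn T V 0 θ n ω = Real.cosh θ ^ n := by
  rw [partitionFn_eq_iterate]
  refine le_antisymm ?_ ?_
  · refine (iterate_transfer_le_pow_mul (Real.cosh_pos θ).le (fun x => ?_) n 0).trans_eq
      (by simp)
    rw [transfer_exp]; simp
  · refine le_trans (by simp) (pow_mul_le_iterate_transfer (Real.cosh_pos θ).le (fun x => ?_) n 0)
    rw [transfer_exp]; simp

theorem shift_symm (x : ℤ) : shift T.symm x ω = shift T (-x) ω := by
  unfold shift
  rw [zpow_neg, ← inv_zpow]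
  rfl

/-- Reflecting the walk reverses the environment and the tilt. -/
theorem partitionFn_symm : partitionFn T.symm V β θ n ω = partitionFn T V β (-θ) n ω := by
  unfold partitionFn walkExp
  rw [← Equiv.sum_comp (Equiv.neg (Fin n → ℤˣ))]
  refine Finset.sum_congr rfl fun z _ => ?_
  simp only [Equiv.neg_apply, pos_neg, shift_symm, neg_neg]
  push_cast
  ring_nf

/-- Joint log-convexity in the inverse temperature and the tilt. -/
theorem log_partitionFn_convex {a b β' θ' : ℝ} (ha : 0 ≤ a) (hb : 0 ≤ b) (hab : a + b = 1) :
    Real.log (partitionFn T V (a * β + b * β') (a * θ + b * θ') n ω) ≤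
      a * Real.log (partitionFn T V β θ n ω) + b * Real.log (partitionFn T V β' θ' n ω) := by
  have h := log_sum_exp_convex (Finset.univ : Finset (Fin n → ℤˣ)) Finset.univ_nonempty
    (fun _ => ∏ _i : Fin n, (1 / 2 : ℝ))
    (fun z => β * ∑ i ∈ Finset.range n, V (shift T (pos z i) ω) + θ * (pos z n : ℝ))
    (fun z => β' * ∑ i ∈ Finset.range n, V (shift T (pos z i) ω) + θ' * (pos z n : ℝ))
    (fun z _ => Finset.prod_pos fun _ _ => by norm_num) ha hb hab
  refine le_trans (le_of_eq ?_) h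
  unfold partitionFn walkExp
  congr 1
  refine Finset.sum_congr rfl fun z _ => ?_
  ring_nf

variable {T V β θ n ω}

/-- A tilt of intermediate size is dominated by the sum of the two extreme tilts. -/
theorem partitionFn_le_add {a : ℝ} (h : |θ| ≤ a) :
    partitionFn T V β θ n ω ≤ partitionFn T V β a n ω + partitionFn T V β (-a) n ω := by
  unfold partitionFn walkExp
  rw [← Finset.sum_add_distrib]
  refine Finset.sum_le_sum fun z _ => ?_
  rw [← mul_add]
  refine mul_le_mul_of_nonneg_left ?_ (Finset.prod_nonneg fun _ _ => by norm_num)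
  have h1 : θ * (pos z n : ℝ) ≤ |a * (pos z n : ℝ)| := by
    refine (le_abs_self _).trans ?_
    rw [abs_mul, abs_mul]
    exact mul_le_mul_of_nonneg_right (h.trans (le_abs_self a)) (abs_nonneg _)
  rcases abs_choice (a * (pos z n : ℝ)) with h2 | h2
  · refine le_add_of_le_of_nonneg (Real.exp_le_exp.2 ?_) (Real.exp_pos _).le
    linarith
  · refine le_add_of_nonneg_of_le (Real.exp_pos _).le (Real.exp_le_exp.2 ?_)
    linarith

end Partition

/-! ### Growth rates -/

/-- Linear bounds with arbitrarily small error determine the limit of `c n / n`. -/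
theorem tendsto_of_linear_bounds {c : ℕ → ℝ} {l : ℝ}
    (h1 : ∀ ε : ℝ, 0 < ε → ∃ B, ∀ n : ℕ, c n ≤ (l + ε) * n + B)
    (h2 : ∀ ε : ℝ, 0 < ε → ∃ B, ∀ n : ℕ, (l - ε) * n - B ≤ c n) :
    Tendsto (fun n : ℕ => 1 / (n : ℝ) * c n) atTop (𝓝 l) := by
  rw [Metric.tendsto_atTop]
  intro ε hε
  obtain ⟨B₁, h1⟩ := h1 (ε / 2) (by positivity)
  obtain ⟨B₂, h2⟩ := h2 (ε / 2) (by positivity)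
  obtain ⟨N, hN⟩ := exists_nat_gt ((|B₁| + |B₂|) / (ε / 2))
  refine ⟨N + 1, fun n hn => ?_⟩
  have hn1 : (N : ℝ) + 1 ≤ n := by exact_mod_cast hn
  have hn0 : (0 : ℝ) < n := by linarith [Nat.cast_nonneg (α := ℝ) N]
  have hB : |B₁| + |B₂| < ε / 2 * n := by
    rw [div_lt_iff₀ (by positivity)] at hN
    nlinarith
  have h1 := h1 n
  have h2 := h2 n
  rw [Real.dist_eq, abs_lt]
  have e : 1 / (n : ℝ) * c n - l = (c n - l * n) / n := by field_simp
  rw [e]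
  constructor
  · rw [lt_div_iff₀ hn0]
    linarith [le_abs_self B₂, abs_nonneg B₁]
  · rw [div_lt_iff₀ hn0]
    linarith [le_abs_self B₁, abs_nonneg B₂]

/-- Conversely, an upper bound on the limit of `c n / n` gives a linear bound for all `n`. -/
theorem exists_linear_bound_of_tendsto {c : ℕ → ℝ} {l l' : ℝ} (hl : l < l')
    (h : Tendsto (fun n : ℕ => 1 / (n : ℝ) * c n) atTop (𝓝 l)) :
    ∃ B, ∀ n : ℕ, c n ≤ l' * n + B := by
  obtain ⟨N, hN⟩ := eventually_atTop.1 (h.eventually (gt_mem_nhds hl))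
  refine ⟨∑ k ∈ Finset.range (N + 1), |c k - l' * k|, fun n => ?_⟩
  have hs : 0 ≤ ∑ k ∈ Finset.range (N + 1), |c k - l' * k| :=
    Finset.sum_nonneg fun _ _ => abs_nonneg _
  by_cases hn : n < N + 1
  · have := Finset.single_le_sum (f := fun k : ℕ => |c k - l' * k|) (fun _ _ => abs_nonneg _)
      (Finset.mem_range.2 hn)
    have h2 := le_abs_self (c n - l' * n)
    linarith
  · have hn0 : (0 : ℝ) < n := by
      have : 0 < n := by omega
      exact_mod_cast this
    have := hN n (by omega)
    rw [one_div, inv_mul_lt_iff₀ hn0] at this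
    linarith

/-- A positive eigenfunction of the transfer operator that grows like `exp (θ x)` determines the
free energy at tilt `θ`: the two weights of the endpoint differ by a subexponential factor. -/
theorem tendsto_log_of_eigenfunction {v U : ℤ → ℝ} {l θ : ℝ}
    (heig : ∀ x, transfer v (fun y => Real.exp (U y)) x = Real.exp l * Real.exp (U x))
    (hU : ∀ ε : ℝ, 0 < ε → ∃ B, ∀ x : ℤ, |U x - θ * x| ≤ ε * |(x : ℝ)| + B) :
    Tendsto (fun n : ℕ => 1 / (n : ℝ) *
      Real.log ((transfer v)^[n] (fun x => Real.exp (θ * x)) 0)) atTop (𝓝 l) := by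
  have hit : ∀ n, (transfer v)^[n] (fun y => Real.exp (U y)) 0 =
      Real.exp (l * n + U 0) := by
    intro n
    rw [Real.exp_add, mul_comm l, Real.exp_nat_mul]
    exact le_antisymm (iterate_transfer_le_pow_mul (Real.exp_pos _).le (fun x => (heig x).le) n 0)
      (pow_mul_le_iterate_transfer (Real.exp_pos _).le (fun x => (heig x).ge) n 0)
  -- comparison of two endpoint weights along paths of length `n`
  have hcomp : ∀ (A B : ℤ → ℝ) (n : ℕ) (M : ℝ), (∀ x : ℤ, |(x : ℝ)| ≤ n → A x ≤ M + B x) →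
      (transfer v)^[n] (fun y => Real.exp (A y)) 0 ≤
        Real.exp M * (transfer v)^[n] (fun y => Real.exp (B y)) 0 := by
    intro A B n M h
    rw [← walkExp_eq_iterate_transfer, ← walkExp_eq_iterate_transfer, ← walkExp_const_mul]
    refine walkExp_mono fun z => ?_
    rw [mul_left_comm, ← Real.exp_add M]
    refine mul_le_mul_of_nonneg_left (Real.exp_le_exp.2 (h _ ?_)) (Real.exp_pos _).le
    rw [zero_add]
    exact_mod_cast abs_pos_le z n
  have hpos : ∀ n, 0 < (transfer v)^[n] (fun x : ℤ => Real.exp (θ * x)) 0 := by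
    intro n
    rw [← walkExp_eq_iterate_transfer]
    exact Finset.sum_pos (fun z _ => mul_pos (Finset.prod_pos fun _ _ => by norm_num)
      (by positivity)) Finset.univ_nonempty
  refine tendsto_of_linear_bounds (fun ε hε => ?_) (fun ε hε => ?_)
  · obtain ⟨B, hB⟩ := hU ε hε
    refine ⟨B + U 0, fun n => ?_⟩
    have h := hcomp (fun x => θ * x) U n (ε * n + B) fun x hx => by
      have h1 := (abs_le.1 (hB x)).1
      have h2 := mul_le_mul_of_nonneg_left hx hε.le
      linarith
    rw [hit, ← Real.exp_add] at h
    rw [Real.log_le_iff_le_exp (hpos n)]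
    refine h.trans (Real.exp_le_exp.2 ?_)
    linarith
  · obtain ⟨B, hB⟩ := hU ε hε
    refine ⟨B - U 0, fun n => ?_⟩
    have h := hcomp U (fun x => θ * x) n (ε * n + B) fun x hx => by
      have h1 := (abs_le.1 (hB x)).2
      have h2 := mul_le_mul_of_nonneg_left hx hε.le
      linarith
    rw [hit] at h
    have h3 := Real.log_le_log (Real.exp_pos _) h
    rw [Real.log_exp, Real.log_mul (Real.exp_pos _).ne' (hpos n).ne', Real.log_exp] at h3
    linarith

/-! ### Confinement to a hill -/

/-- The profile of the ground state of the walk killed outside `{k, …, k + m}`. -/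
def hillProfile (k m : ℕ) (x : ℤ) : ℝ :=
  if (k : ℤ) ≤ x ∧ x ≤ k + m then Real.sin (Real.pi * ((x : ℝ) - k + 1) / (m + 2)) else 0

theorem hillProfile_nonneg (k m : ℕ) (x : ℤ) : 0 ≤ hillProfile k m x := by
  unfold hillProfile
  split_ifs with h
  · have h1 : (k : ℝ) ≤ x := by exact_mod_cast h.1
    have h2 : (x : ℝ) ≤ k + m := by exact_mod_cast h.2
    refine Real.sin_nonneg_of_nonneg_of_le_pi ?_ ?_
    · have := Real.pi_pos
      have : 0 ≤ (x : ℝ) - k + 1 := by linarith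
      positivity
    · rw [div_le_iff₀ (by positivity)]
      exact mul_le_mul_of_nonneg_left (by linarith) Real.pi_pos.le
  · exact le_rfl

theorem hillProfile_left_pos (k m : ℕ) : 0 < hillProfile k m k := by
  unfold hillProfile
  rw [if_pos (by constructor <;> omega)]
  refine Real.sin_pos_of_pos_of_lt_pi ?_ ?_
  · have := Real.pi_pos
    simp only [Int.cast_natCast, sub_self, zero_add]
    positivity
  · rw [div_lt_iff₀ (by positivity)]
    refine mul_lt_mul_of_pos_left ?_ Real.pi_pos
    simp only [Int.cast_natCast]
    have : (0 : ℝ) ≤ m := Nat.cast_nonneg m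
    linarith

/-- Also at the two neighbours of the hill the profile is given by the sine. -/
theorem hillProfile_eq_sin {k m : ℕ} {x : ℤ} (h1 : (k : ℤ) - 1 ≤ x) (h2 : x ≤ k + m + 1) :
    hillProfile k m x = Real.sin (Real.pi * ((x : ℝ) - k + 1) / (m + 2)) := by
  unfold hillProfile
  split_ifs with h
  · rfl
  · have : x = k - 1 ∨ x = k + m + 1 := by omega
    rcases this with rfl | rfl
    · push_cast
      ring_nf
      simp
    · push_cast
      have e : Real.pi * ((k : ℝ) + m + 1 - k + 1) / (m + 2) = Real.pi := by
        have : (m : ℝ) + 2 ≠ 0 := by positivity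
        field_simp
        ring
      rw [e, Real.sin_pi]

/-- On a hill of height `c` the profile is a subsolution at level
`exp c * cos (π / (m + 2))`. -/
theorem mul_hillProfile_le_transfer {v : ℤ → ℝ} {k m : ℕ} {c : ℝ}
    (hc : ∀ x : ℤ, (k : ℤ) ≤ x → x ≤ k + m → c ≤ v x) (x : ℤ) :
    Real.exp c * Real.cos (Real.pi / (m + 2)) * hillProfile k m x ≤
      transfer v (hillProfile k m) x := by
  have hn := hillProfile_nonneg k m
  by_cases h : (k : ℤ) ≤ x ∧ x ≤ k + m
  · have e1 : hillProfile k m (x + 1) + hillProfile k m (x - 1) =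
        2 * (Real.cos (Real.pi / (m + 2)) * hillProfile k m x) := by
      rw [hillProfile_eq_sin (by omega) (by omega), hillProfile_eq_sin (by omega) (by omega),
        hillProfile_eq_sin (by omega) (by omega)]
      push_cast
      have a1 : Real.pi * ((x : ℝ) + 1 - k + 1) / (m + 2) =
        Real.pi * ((x : ℝ) - k + 1) / (m + 2) + Real.pi / (m + 2) := by ring
      have a2 : Real.pi * ((x : ℝ) - 1 - k + 1) / (m + 2) =
        Real.pi * ((x : ℝ) - k + 1) / (m + 2) - Real.pi / (m + 2) := by ring
      rw [a1, a2, Real.sin_add, Real.sin_sub]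
      ring
    have h0 : 0 ≤ Real.cos (Real.pi / (m + 2)) * hillProfile k m x := by
      have := add_nonneg (hn (x + 1)) (hn (x - 1))
      rw [e1] at this
      linarith
    unfold transfer
    rw [e1, mul_div_cancel_left₀ _ two_ne_zero, mul_assoc]
    exact mul_le_mul_of_nonneg_right (Real.exp_le_exp.2 (hc x h.1 h.2)) h0
  · have e : hillProfile k m x = 0 := if_neg h
    rw [e, mul_zero]
    have h1 := hn (x + 1)
    have h2 := hn (x - 1)
    unfold transfer
    positivity

theorem iterate_transfer_nonneg {v f : ℤ → ℝ} (hf : ∀ x, 0 ≤ f x) (n : ℕ) (x : ℤ) :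
    0 ≤ (transfer v)^[n] f x := by
  rw [← walkExp_eq_iterate_transfer]
  exact Finset.sum_nonneg fun z _ => mul_nonneg (Finset.prod_nonneg fun _ _ => by norm_num)
    (mul_nonneg (Real.exp_pos _).le (hf _))

theorem iterate_transfer_pos {v f : ℤ → ℝ} (hf : ∀ x, 0 ≤ f x) (n : ℕ) (x : ℤ)
    (h : 0 < f (x + n)) : 0 < (transfer v)^[n] f x := by
  induction n generalizing x with
  | zero => simpa using h
  | succ n ih =>
    rw [Function.iterate_succ_apply', transfer]
    have h1 := ih (x + 1) (by convert h using 2; push_cast; ring)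
    have h2 := iterate_transfer_nonneg (v := v) hf n (x - 1)
    positivity

/-- A walk that goes to a hill of height `c` and stays there contributes
`exp (c n) * cos (π / (m + 2)) ^ n`, up to a constant, to the partition function. -/
theorem exists_linear_lower_bound_of_hill {v : ℤ → ℝ} {M : ℝ} (hM : ∀ x, v x ≤ M) {k m : ℕ}
    (hm : 1 ≤ m) {c : ℝ} (hc : ∀ x : ℤ, (k : ℤ) ≤ x → x ≤ k + m → c ≤ v x) (θ : ℝ) :
    ∃ B, ∀ n : ℕ, (c + Real.log (Real.cos (Real.pi / (m + 2)))) * n - B ≤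
      Real.log ((transfer v)^[n] (fun x => Real.exp (θ * x)) 0) := by
  have hcos : 0 < Real.cos (Real.pi / (m + 2)) := by
    have hm' : (1 : ℝ) ≤ m := by exact_mod_cast hm
    refine Real.cos_pos_of_mem_Ioo ⟨?_, ?_⟩
    · have := Real.pi_pos
      have : 0 < Real.pi / (m + 2) := by positivity
      linarith
    · exact div_lt_div_of_pos_left Real.pi_pos two_pos (by linarith)
  set ρ : ℝ := Real.exp c * Real.cos (Real.pi / (m + 2)) with hρ
  have hρ0 : 0 < ρ := by positivity
  -- the profile propagated for `k` steps, so that it is positive at the origin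
  set f : ℤ → ℝ := (transfer v)^[k] (hillProfile k m) with hf
  have hf0 : 0 < f 0 := iterate_transfer_pos (hillProfile_nonneg k m) k 0
    (by rw [zero_add]; exact hillProfile_left_pos k m)
  have hsub : ∀ x, ρ * f x ≤ transfer v f x := by
    intro x
    have h := iterate_transfer_mono (v := v) (mul_hillProfile_le_transfer hc) k x
    rw [iterate_transfer_const_mul, ← Function.iterate_succ_apply,
      Function.iterate_succ_apply'] at h
    exact h
  set C : ℝ := Real.exp (|θ| * (k + m)) with hC
  have hprof : ∀ x : ℤ, hillProfile k m x ≤ C * Real.exp (θ * x) := by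
    intro x
    rw [hC, ← Real.exp_add]
    unfold hillProfile
    split_ifs with h
    · refine (Real.sin_le_one _).trans (Real.one_le_exp ?_)
      have h1 : (0 : ℝ) ≤ x := by
        have : (0 : ℤ) ≤ x := by omega
        exact_mod_cast this
      have h2 : (x : ℝ) ≤ k + m := by exact_mod_cast h.2
      have h3 := mul_le_mul_of_nonneg_left h2 (abs_nonneg θ)
      have h4 := mul_le_mul_of_nonneg_right (neg_abs_le θ) h1
      linarith
    · exact (Real.exp_pos _).le
  set D : ℝ := C * (Real.exp M * Real.cosh θ) ^ k with hD
  have hD0 : 0 < D := by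
    have := Real.cosh_pos θ
    positivity
  have hfle : ∀ x, f x ≤ D * Real.exp (θ * x) := by
    intro x
    have h := iterate_transfer_mono (v := v) hprof k x
    rw [iterate_transfer_const_mul] at h
    refine h.trans ?_
    rw [hD, mul_assoc]
    refine mul_le_mul_of_nonneg_left (iterate_transfer_le_pow_mul
      (mul_pos (Real.exp_pos _) (Real.cosh_pos θ)).le (fun y => ?_) k x) (Real.exp_pos _).le
    rw [transfer_exp]
    have := Real.cosh_pos θ
    have := Real.exp_le_exp.2 (hM y)
    gcongr
  refine ⟨Real.log D - Real.log (f 0), fun n => ?_⟩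
  have h1 := pow_mul_le_iterate_transfer hρ0.le hsub n 0
  have h2 := iterate_transfer_mono (v := v) hfle n 0
  rw [iterate_transfer_const_mul] at h2
  have h3 := h1.trans h2
  have hZ : 0 < (transfer v)^[n] (fun x : ℤ => Real.exp (θ * x)) 0 := by
    have := (mul_pos (pow_pos hρ0 n) hf0).trans_le h3
    exact pos_of_mul_pos_right this hD0.le
  have h4 := Real.log_le_log (mul_pos (pow_pos hρ0 n) hf0) h3
  rw [Real.log_mul (pow_pos hρ0 n).ne' hf0.ne', Real.log_mul hD0.ne' hZ.ne', Real.log_pow, hρ,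
    Real.log_mul (Real.exp_pos _).ne' hcos.ne', Real.log_exp] at h4
  linarith

/-! ### Potential functions on the integers -/

/-- The function on `ℤ` that vanishes at `0` and has the increments `s`. -/
def intSum (s : ℤ → ℝ) (x : ℤ) : ℝ :=
  ∑ i ∈ Finset.range x.toNat, s i - ∑ i ∈ Finset.range (-x).toNat, s (-(i + 1))

theorem intSum_natCast (s : ℤ → ℝ) (n : ℕ) :
    intSum s n = ∑ i ∈ Finset.range n, s i := by simp [intSum]

theorem intSum_neg_natCast (s : ℤ → ℝ) (n : ℕ) :
    intSum s (-n) = -∑ i ∈ Finset.range n, s (-(i + 1)) := by simp [intSum]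

theorem intSum_add_one (s : ℤ → ℝ) (x : ℤ) : intSum s (x + 1) = intSum s x + s x := by
  obtain ⟨n, rfl | rfl⟩ := x.eq_nat_or_neg
  · rw [← Nat.cast_succ, intSum_natCast, intSum_natCast, Finset.sum_range_succ]
  · cases n with
    | zero => simp [intSum]
    | succ n =>
      have e : -((n + 1 : ℕ) : ℤ) + 1 = -(n : ℤ) := by push_cast; ring
      rw [e, intSum_neg_natCast, intSum_neg_natCast, Finset.sum_range_succ]
      push_cast
      ring

section Shift

variable {Ω : Type*} [MeasurableSpace Ω] (T : Ω ≃ᵐ Ω)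

theorem shift_add (x y : ℤ) (ω : Ω) : shift T (x + y) ω = shift T x (shift T y ω) := by
  unfold shift
  rw [zpow_add]
  rfl

theorem shift_natCast (n : ℕ) (ω : Ω) : shift T n ω = T^[n] ω := by
  unfold shift
  rw [zpow_natCast]
  exact congrFun (Equiv.Perm.iterate_eq_pow _ n).symm ω

theorem shift_neg_natCast (n : ℕ) (ω : Ω) : shift T (-n) ω = T.symm^[n] ω := by
  rw [← shift_symm, shift_natCast]

theorem symm_shift (x : ℤ) (ω : Ω) : T.symm (shift T x ω) = shift T (x - 1) ω := by
  have h := shift_add T (-(1 : ℕ)) x ω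
  rw [shift_neg_natCast] at h
  rw [sub_eq_neg_add]
  exact h.symm

theorem measurable_shift (x : ℤ) : Measurable (shift T x) := by
  obtain ⟨n, rfl | rfl⟩ := x.eq_nat_or_neg
  · rw [funext (shift_natCast T n)]; exact T.measurable.iterate n
  · rw [funext (shift_neg_natCast T n)]; exact T.symm.measurable.iterate n

end Shift

/-! ### Existence of the free energy -/

section FreeEnergy

variable {Ω : Type*} [MeasurableSpace Ω] {μ : Measure Ω} {T : Ω ≃ᵐ Ω} {V : Ω → ℝ}
  {β θ l : ℝ}

theorem IsTiltedFreeEnergy.of_symm (h : IsTiltedFreeEnergy μ T.symm V β θ l) :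
    IsTiltedFreeEnergy μ T V β (-θ) l := by
  filter_upwards [h] with ω hω
  simpa only [partitionFn_symm] using hω

theorem isTiltedFreeEnergy_zero_left : IsTiltedFreeEnergy μ T V 0 θ (Real.log (Real.cosh θ)) := by
  refine ae_of_all _ fun ω => ?_
  refine tendsto_const_nhds.congr' ?_
  filter_upwards [eventually_ge_atTop 1] with n hn
  rw [partitionFn_zero_left, Real.log_pow]
  have : (n : ℝ) ≠ 0 := by positivity
  field_simp

variable [IsProbabilityMeasure μ]

theorem IsTiltedFreeEnergy.unique {l' : ℝ} (h : IsTiltedFreeEnergy μ T V β θ l)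
    (h' : IsTiltedFreeEnergy μ T V β θ l') : l = l' := by
  obtain ⟨ω, h1, h2⟩ := (h.and h').exists
  exact tendsto_nhds_unique h1 h2

theorem IsTiltedFreeEnergy.eq (h : IsTiltedFreeEnergy μ T V β θ l) :
    tiltedFreeEnergy μ T V β θ = l :=
  (Classical.epsilon_spec (p := fun L => IsTiltedFreeEnergy μ T V β θ L) ⟨l, h⟩ :
    IsTiltedFreeEnergy μ T V β θ (tiltedFreeEnergy μ T V β θ)).unique h

/-- At the tilt equal to the Lyapunov exponent of level `l > β` the free energy is `l`: by the
ergodic theorem the eigenfunction at level `l` grows at the rate of the tilt. -/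
theorem isTiltedFreeEnergy_lyapunov_symm (hT : Ergodic T μ) (hVm : Measurable V)
    (hV : ∀ ω, V ω ∈ Icc (0 : ℝ) 1) (hβ : 0 < β) (hl : β < l) :
    IsTiltedFreeEnergy μ T V β (lyapunov μ T.symm V β l) l := by
  have hpm : Measurable (logRatio T.symm V β l) := measurable_logRatio hVm T.symm.measurable
  have h1 := ae_abs_birkhoffSum_sub_le hT hpm (abs_logRatio_le hV hβ hl)
  have h2 := ae_abs_birkhoffSum_sub_le hT.symm (hpm.comp T.symm.measurable)
    (fun ω => abs_logRatio_le hV hβ hl (T.symm ω))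
  filter_upwards [h1, h2] with ω h1 h2
  simp only [partitionFn_eq_iterate]
  refine tendsto_log_of_eigenfunction
    (U := intSum fun x => logRatio T.symm V β l (shift T x ω)) (fun x => ?_) (fun ε hε => ?_)
  · have e1 := intSum_add_one (fun x => logRatio T.symm V β l (shift T x ω)) x
    have e2 := intSum_add_one (fun x => logRatio T.symm V β l (shift T x ω)) (x - 1)
    rw [sub_add_cancel] at e2
    have e3 := exp_logRatio_add (S := T.symm) hV hβ hl (shift T x ω)
    rw [symm_shift, coeff] at e3
    simp only [transfer]
    rw [e1, Real.exp_add, ← sub_eq_iff_eq_add.2 e2, sub_eq_add_neg, Real.exp_add, ← mul_add, e3,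
      Real.exp_sub]
    field_simp
  · obtain ⟨B₁, h1⟩ := h1 ε hε
    obtain ⟨B₂, h2⟩ := h2 ε hε
    simp only [Function.comp_apply] at h2
    rw [integral_comp_eq hT.symm.toMeasurePreserving hpm] at h2
    refine ⟨max B₁ B₂, fun x => ?_⟩
    obtain ⟨n, rfl | rfl⟩ := x.eq_nat_or_neg
    · have := h1 n
      rw [intSum_natCast]
      simp only [shift_natCast, Int.cast_natCast, Nat.abs_cast]
      exact this.trans (by gcongr; exact le_max_left _ _)
    · have := h2 n
      rw [intSum_neg_natCast]
      have e : ∀ i : ℕ, shift T (-((i : ℤ) + 1)) ω = T.symm (T.symm^[i] ω) := fun i => by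
        rw [← Nat.cast_succ, shift_neg_natCast, Function.iterate_succ_apply']
      simp only [e, Int.cast_neg, Int.cast_natCast, abs_neg, Nat.abs_cast]
      refine le_trans (le_of_eq ?_) (this.trans (by gcongr; exact le_max_right _ _))
      rw [← abs_neg]
      congr 1
      simp only [birkhoffSum, Function.comp_apply, lyapunov]
      ring

theorem isTiltedFreeEnergy_lyapunov (hT : Ergodic T μ) (hVm : Measurable V)
    (hV : ∀ ω, V ω ∈ Icc (0 : ℝ) 1) (hβ : 0 < β) (hl : β < l) :
    IsTiltedFreeEnergy μ T V β (lyapunov μ T V β l) l := by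
  rw [← lyapunov_symm hT.toMeasurePreserving hVm hV hβ hl]
  exact isTiltedFreeEnergy_lyapunov_symm hT hVm hV hβ hl

theorem isTiltedFreeEnergy_neg_lyapunov (hT : Ergodic T μ) (hVm : Measurable V)
    (hV : ∀ ω, V ω ∈ Icc (0 : ℝ) 1) (hβ : 0 < β) (hl : β < l) :
    IsTiltedFreeEnergy μ T V β (-lyapunov μ T V β l) l :=
  (isTiltedFreeEnergy_lyapunov_symm (T := T.symm) hT.symm hVm hV hβ hl).of_symm

theorem measurableSet_isHill (hVm : Measurable V) (h : ℝ) (k m : ℤ) :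
    MeasurableSet {ω | IsHill T V ω h k m} := by
  have e : {ω | IsHill T V ω h k m} = ⋂ y ∈ Icc k m, {ω | h ≤ V (shift T y ω)} := by
    ext ω; simp [IsHill]
  rw [e]
  exact MeasurableSet.biInter (to_countable _) fun y _ =>
    measurableSet_le measurable_const (hVm.comp (measurable_shift T y))

/-- Arbitrarily long and high hills force the growth rate `β` at every tilt. -/
theorem ae_exists_linear_lower_bound (hT : Ergodic T μ) (hVm : Measurable V)
    (hV : ∀ ω, V ω ∈ Icc (0 : ℝ) 1) (hβ : 0 < β)
    (hhill : ∀ h ∈ Ioo (0 : ℝ) 1, ∀ m : ℕ, 1 ≤ m → 0 < μ {ω | IsHill T V ω h 0 m}) :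
    ∀ᵐ ω ∂μ, ∀ θ ε : ℝ, 0 < ε → ∃ B, ∀ n : ℕ,
      (β - ε) * n - B ≤ Real.log (partitionFn T V β θ n ω) := by
  have hvis : ∀ᵐ ω ∂μ, ∀ i : ℕ, ∃ k : ℕ,
      T^[k] ω ∈ {ω | IsHill T V ω (1 - 1 / ((i : ℝ) + 2)) 0 ((i + 1 : ℕ) : ℤ)} := by
    refine ae_all_iff.2 fun i => ae_exists_iterate_mem hT (measurableSet_isHill hVm _ _ _)
      (hhill _ ⟨?_, ?_⟩ _ (by omega))
    · rw [sub_pos, div_lt_one (by positivity)]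
      linarith [Nat.cast_nonneg (α := ℝ) i]
    · have : 0 < 1 / ((i : ℝ) + 2) := by positivity
      linarith
  have hlim : Tendsto (fun i : ℕ => β * (1 - 1 / ((i : ℝ) + 2)) +
      Real.log (Real.cos (Real.pi / (((i + 1 : ℕ) : ℝ) + 2)))) atTop (𝓝 β) := by
    have t1 : Tendsto (fun i : ℕ => 1 / ((i : ℝ) + 2)) atTop (𝓝 0) :=
      tendsto_const_nhds.div_atTop
        (tendsto_atTop_add_const_right _ _ tendsto_natCast_atTop_atTop)
    have t2 : Tendsto (fun i : ℕ => Real.pi / (((i + 1 : ℕ) : ℝ) + 2)) atTop (𝓝 0) :=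
      tendsto_const_nhds.div_atTop (tendsto_atTop_add_const_right _ _
        (tendsto_natCast_atTop_atTop.comp (tendsto_add_atTop_nat 1)))
    have t3 := ((Real.continuous_cos.tendsto 0).comp t2).log (by simp)
    have := ((t1.const_sub 1).const_mul β).add t3
    simpa using this
  filter_upwards [hvis] with ω hω θ ε hε
  obtain ⟨i, hi⟩ := (hlim.eventually (lt_mem_nhds (show β - ε < β by linarith))).exists
  obtain ⟨k, hk⟩ := hω i
  have hM : ∀ x, β * V (shift T x ω) ≤ β := fun x => by nlinarith [(hV (shift T x ω)).2]
  obtain ⟨B, hB⟩ := exists_linear_lower_bound_of_hill hM (k := k) (m := i + 1) (by omega)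
    (c := β * (1 - 1 / ((i : ℝ) + 2))) (fun x h1 h2 => by
      refine mul_le_mul_of_nonneg_left ?_ hβ.le
      have := hk (x - k) ⟨by omega, by omega⟩
      rwa [← shift_natCast, ← shift_add, sub_add_cancel] at this) θ
  refine ⟨B, fun n => ?_⟩
  rw [partitionFn_eq_iterate]
  refine le_trans ?_ (hB n)
  have : (β - ε) * n ≤ (β * (1 - 1 / ((i : ℝ) + 2)) +
      Real.log (Real.cos (Real.pi / (((i + 1 : ℕ) : ℝ) + 2)))) * n := by gcongr
  linarith

/-- Below all Lyapunov exponents the free energy sticks to the value `β`. -/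
theorem isTiltedFreeEnergy_flat (hT : Ergodic T μ) (hVm : Measurable V)
    (hV : ∀ ω, V ω ∈ Icc (0 : ℝ) 1) (hβ : 0 < β)
    (hhill : ∀ h ∈ Ioo (0 : ℝ) 1, ∀ m : ℕ, 1 ≤ m → 0 < μ {ω | IsHill T V ω h 0 m})
    (hθ : ∀ l, β < l → |θ| ≤ lyapunov μ T V β l) :
    IsTiltedFreeEnergy μ T V β θ β := by
  have hup : ∀ᵐ ω ∂μ, ∀ k : ℕ, ∃ B, ∀ n : ℕ,
      Real.log (partitionFn T V β θ n ω) ≤ (β + 1 / ((k : ℝ) + 1)) * n + B := by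
    refine ae_all_iff.2 fun k => ?_
    have hk : 0 < 1 / ((k : ℝ) + 1) := by positivity
    set l := β + 1 / ((k : ℝ) + 1) / 2 with hl
    have hβl : β < l := by linarith
    filter_upwards [isTiltedFreeEnergy_lyapunov hT hVm hV hβ hβl,
      isTiltedFreeEnergy_neg_lyapunov hT hVm hV hβ hβl] with ω h1 h2
    have hlk : l < β + 1 / ((k : ℝ) + 1) := by linarith
    obtain ⟨B₁, h1⟩ := exists_linear_bound_of_tendsto hlk h1
    obtain ⟨B₂, h2⟩ := exists_linear_bound_of_tendsto hlk h2
    refine ⟨Real.log 2 + max B₁ B₂, fun n => ?_⟩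
    have h3 := partitionFn_le_add (T := T) (V := V) (β := β) (n := n) (ω := ω) (hθ l hβl)
    have h1 := h1 n
    have h2 := h2 n
    rw [Real.log_le_iff_le_exp (partitionFn_pos ..)] at h1 h2 ⊢
    have e : Real.exp ((β + 1 / ((k : ℝ) + 1)) * n + (Real.log 2 + max B₁ B₂)) =
        2 * Real.exp ((β + 1 / ((k : ℝ) + 1)) * n + max B₁ B₂) := by
      rw [add_left_comm, Real.exp_add, Real.exp_log two_pos]
    rw [e, two_mul]
    refine h3.trans (add_le_add (h1.trans (Real.exp_le_exp.2 ?_))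
      (h2.trans (Real.exp_le_exp.2 ?_)))
    · linarith [le_max_left B₁ B₂]
    · linarith [le_max_right B₁ B₂]
  filter_upwards [hup, ae_exists_linear_lower_bound hT hVm hV hβ hhill] with ω h1 h2
  refine tendsto_of_linear_bounds (fun ε hε => ?_) (h2 θ)
  obtain ⟨k, hk⟩ := exists_nat_one_div_lt hε
  obtain ⟨B, hB⟩ := h1 k
  exact ⟨B, fun n => (hB n).trans (by gcongr)⟩

/-- Joint convexity of the free energy in the inverse temperature and the tilt. -/
theorem IsTiltedFreeEnergy.convex {a b β' θ' l' m : ℝ} (h : IsTiltedFreeEnergy μ T V β θ l)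
    (h' : IsTiltedFreeEnergy μ T V β' θ' l') (ha : 0 ≤ a) (hb : 0 ≤ b) (hab : a + b = 1)
    (hm : IsTiltedFreeEnergy μ T V (a * β + b * β') (a * θ + b * θ') m) :
    m ≤ a * l + b * l' := by
  obtain ⟨ω, h1, h2, h3⟩ := (h.and (h'.and hm)).exists
  refine le_of_tendsto_of_tendsto' h3 ((h1.const_mul a).add (h2.const_mul b)) fun n => ?_
  have := mul_le_mul_of_nonneg_left
    (log_partitionFn_convex T V β θ n ω (β' := β') (θ' := θ') ha hb hab)
    (show 0 ≤ 1 / (n : ℝ) by positivity)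
  linarith

end FreeEnergy

/-! ### The free energy as the inverse of the Lyapunov exponent -/

/-- The half-width of the flat piece of the free energy: the infimum of the Lyapunov exponents at
the levels above `β`. -/
def critTilt {Ω : Type*} [MeasurableSpace Ω] (μ : Measure Ω) (T : Ω ≃ᵐ Ω) (V : Ω → ℝ)
    (β : ℝ) : ℝ :=
  sInf (lyapunov μ T V β '' Ioi β)

section Inverse

variable {Ω : Type*} [MeasurableSpace Ω] {μ : Measure Ω} [IsProbabilityMeasure μ] {T : Ω ≃ᵐ Ω}
  {V : Ω → ℝ} {β θ l : ℝ}

theorem integrable_potential (hVm : Measurable V) (hV : ∀ ω, V ω ∈ Icc (0 : ℝ) 1) :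
    Integrable V μ :=
  integrable_of_abs_le hVm (C := 1) fun ω => by
    rw [abs_of_nonneg (hV ω).1]; exact (hV ω).2

theorem integral_potential_pos (hVm : Measurable V) (hV : ∀ ω, V ω ∈ Icc (0 : ℝ) 1)
    (hsup : essSup V μ = 1) : 0 < ∫ ω, V ω ∂μ := by
  refine lt_of_le_of_ne (integral_nonneg fun ω => (hV ω).1) fun h => ?_
  have h0 := (integral_eq_zero_iff_of_nonneg (fun ω => (hV ω).1)
    (integrable_potential (μ := μ) hVm hV)).1 h.symm
  have h1 : essSup V μ = essSup (fun _ => (0 : ℝ)) μ := essSup_congr_ae h0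
  rw [essSup_const _ (IsProbabilityMeasure.ne_zero μ), hsup] at h1
  exact one_ne_zero h1

theorem integral_potential_lt_one (hVm : Measurable V) (hV : ∀ ω, V ω ∈ Icc (0 : ℝ) 1)
    (hinf : essInf V μ = 0) : ∫ ω, V ω ∂μ < 1 := by
  have hi := integrable_potential (μ := μ) hVm hV
  have hnn : ∀ ω, 0 ≤ 1 - V ω := fun ω => sub_nonneg.2 (hV ω).2
  have e : ∫ ω, (1 - V ω) ∂μ = 1 - ∫ ω, V ω ∂μ := by
    rw [integral_sub (integrable_const _) hi]; simp
  refine sub_pos.1 (e ▸ lt_of_le_of_ne (integral_nonneg hnn) fun h => ?_)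
  have h0 := (integral_eq_zero_iff_of_nonneg hnn ((integrable_const _).sub hi)).1 h.symm
  have h1 : essInf V μ = essInf (fun _ => (1 : ℝ)) μ := by
    refine essInf_congr_ae ?_
    filter_upwards [h0] with ω hω
    have : 1 - V ω = 0 := hω
    linarith
  rw [essInf_const _ (IsProbabilityMeasure.ne_zero μ), hinf] at h1
  exact zero_ne_one h1

theorem hasDerivAt_lyapunov' (hT : MeasurePreserving T μ μ) (hVm : Measurable V)
    (hV : ∀ ω, V ω ∈ Icc (0 : ℝ) 1) (hβ : 0 < β) (hl : β < l) :
    HasDerivAt (lyapunov μ T V β) (lyapunovDeriv μ T V β l) l := by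
  refine (hasDerivAt_lyapunov hT hVm hV hβ hl).congr_of_eventuallyEq ?_
  filter_upwards [lt_mem_nhds hl] with l' hl'
  exact (lyapunov_symm hT hVm hV hβ hl').symm

theorem continuousOn_lyapunov (hT : MeasurePreserving T μ μ) (hVm : Measurable V)
    (hV : ∀ ω, V ω ∈ Icc (0 : ℝ) 1) (hβ : 0 < β) : ContinuousOn (lyapunov μ T V β) (Ioi β) :=
  fun _ hl => (hasDerivAt_lyapunov' hT hVm hV hβ hl).continuousAt.continuousWithinAt

theorem critTilt_le_lyapunov (hVm : Measurable V) (hV : ∀ ω, V ω ∈ Icc (0 : ℝ) 1) (hβ : 0 < β)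
    (hl : β < l) : critTilt μ T V β ≤ lyapunov μ T V β l :=
  csInf_le ⟨0, by
    rintro _ ⟨l', hl', rfl⟩
    have := sub_le_lyapunov (μ := μ) hVm hV T.measurable hβ hl'
    have hl'' : β < l' := hl'
    linarith⟩ ⟨l, hl, rfl⟩

theorem mul_one_sub_le_critTilt (hT : MeasurePreserving T μ μ) (hVm : Measurable V)
    (hV : ∀ ω, V ω ∈ Icc (0 : ℝ) 1) (hβ : 0 < β) :
    β * (1 - ∫ ω, V ω ∂μ) ≤ critTilt μ T V β := by
  refine le_csInf (nonempty_Ioi.image _) ?_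
  rintro _ ⟨l, hl, rfl⟩
  have := sub_mul_integral_le_lyapunov (μ := μ) hT hVm hV hβ hl
  have hl' : β < l := hl
  linarith

theorem exists_lyapunov_eq (hT : MeasurePreserving T μ μ) (hVm : Measurable V)
    (hV : ∀ ω, V ω ∈ Icc (0 : ℝ) 1) (hβ : 0 < β) (hθ : critTilt μ T V β < θ) :
    ∃ l, β < l ∧ lyapunov μ T V β l = θ := by
  obtain ⟨_, ⟨l₁, hl₁, rfl⟩, h₁⟩ := exists_lt_of_csInf_lt (nonempty_Ioi.image _) hθ
  set l₂ := max l₁ (β + θ) with hl₂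
  have hl₁' : β < l₁ := hl₁
  have h₂ : β < l₂ := hl₁'.trans_le (le_max_left _ _)
  have h₃ : θ ≤ lyapunov μ T V β l₂ := by
    have := sub_le_lyapunov (μ := μ) hVm hV T.measurable hβ h₂
    have := le_max_right l₁ (β + θ)
    linarith
  obtain ⟨l, hl, rfl⟩ := intermediate_value_Icc (le_max_left l₁ (β + θ))
    ((continuousOn_lyapunov hT hVm hV hβ).mono fun x hx => hl₁'.trans_le hx.1) ⟨h₁.le, h₃⟩
  exact ⟨l, hl₁'.trans_le hl.1, rfl⟩

theorem tiltedFreeEnergy_lyapunov (hT : Ergodic T μ) (hVm : Measurable V)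
    (hV : ∀ ω, V ω ∈ Icc (0 : ℝ) 1) (hβ : 0 < β) (hl : β < l) :
    tiltedFreeEnergy μ T V β (lyapunov μ T V β l) = l :=
  (isTiltedFreeEnergy_lyapunov hT hVm hV hβ hl).eq

theorem isTiltedFreeEnergy_of_abs_le
    (hhill : ∀ h ∈ Ioo (0 : ℝ) 1, ∀ m : ℕ, 1 ≤ m → 0 < μ {ω | IsHill T V ω h 0 m})
    (hT : Ergodic T μ) (hVm : Measurable V)
    (hV : ∀ ω, V ω ∈ Icc (0 : ℝ) 1) (hβ : 0 < β) (hθ : |θ| ≤ critTilt μ T V β) :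
    IsTiltedFreeEnergy μ T V β θ β :=
  isTiltedFreeEnergy_flat hT hVm hV hβ hhill fun _ hl =>
    hθ.trans (critTilt_le_lyapunov hVm hV hβ hl)

theorem isTiltedFreeEnergy_tiltedFreeEnergy
    (hhill : ∀ h ∈ Ioo (0 : ℝ) 1, ∀ m : ℕ, 1 ≤ m → 0 < μ {ω | IsHill T V ω h 0 m})
    (hT : Ergodic T μ) (hVm : Measurable V)
    (hV : ∀ ω, V ω ∈ Icc (0 : ℝ) 1) (hβ : 0 < β) (θ : ℝ) :
    IsTiltedFreeEnergy μ T V β θ (tiltedFreeEnergy μ T V β θ) := by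
  suffices h : ∃ L, IsTiltedFreeEnergy μ T V β θ L by
    obtain ⟨L, hL⟩ := h
    rwa [hL.eq]
  by_cases h : |θ| ≤ critTilt μ T V β
  · exact ⟨β, isTiltedFreeEnergy_of_abs_le hhill hT hVm hV hβ h⟩
  · obtain ⟨l, hl, hθ⟩ := exists_lyapunov_eq hT.toMeasurePreserving hVm hV hβ (not_le.1 h)
    rcases abs_choice θ with h' | h'
    · exact ⟨l, by rw [← h', ← hθ]; exact isTiltedFreeEnergy_lyapunov hT hVm hV hβ hl⟩
    · refine ⟨l, ?_⟩
      have := isTiltedFreeEnergy_neg_lyapunov hT hVm hV hβ hl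
      rwa [hθ, h', neg_neg] at this

theorem tiltedFreeEnergy_neg
    (hhill : ∀ h ∈ Ioo (0 : ℝ) 1, ∀ m : ℕ, 1 ≤ m → 0 < μ {ω | IsHill T V ω h 0 m})
    (hT : Ergodic T μ) (hVm : Measurable V)
    (hV : ∀ ω, V ω ∈ Icc (0 : ℝ) 1) (hβ : 0 < β) (θ : ℝ) :
    tiltedFreeEnergy μ T V β (-θ) = tiltedFreeEnergy μ T V β θ := by
  wlog hθ : 0 ≤ θ generalizing θ
  · rw [← this (-θ) (by linarith), neg_neg]
  by_cases h : |θ| ≤ critTilt μ T V β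
  · rw [(isTiltedFreeEnergy_of_abs_le hhill hT hVm hV hβ h).eq,
      (isTiltedFreeEnergy_of_abs_le hhill hT hVm hV hβ (θ := -θ) (by rwa [abs_neg])).eq]
  · rw [abs_of_nonneg hθ] at h
    obtain ⟨l, hl, rfl⟩ := exists_lyapunov_eq hT.toMeasurePreserving hVm hV hβ (not_le.1 h)
    rw [tiltedFreeEnergy_lyapunov hT hVm hV hβ hl,
      (isTiltedFreeEnergy_neg_lyapunov hT hVm hV hβ hl).eq]

theorem tiltedFreeEnergy_abs
    (hhill : ∀ h ∈ Ioo (0 : ℝ) 1, ∀ m : ℕ, 1 ≤ m → 0 < μ {ω | IsHill T V ω h 0 m})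
    (hT : Ergodic T μ) (hVm : Measurable V)
    (hV : ∀ ω, V ω ∈ Icc (0 : ℝ) 1) (hβ : 0 < β) (θ : ℝ) :
    tiltedFreeEnergy μ T V β |θ| = tiltedFreeEnergy μ T V β θ := by
  rcases abs_choice θ with h | h
  · rw [h]
  · rw [h, tiltedFreeEnergy_neg hhill hT hVm hV hβ]

theorem tiltedFreeEnergy_eq_iff
    (hhill : ∀ h ∈ Ioo (0 : ℝ) 1, ∀ m : ℕ, 1 ≤ m → 0 < μ {ω | IsHill T V ω h 0 m})
    (hT : Ergodic T μ) (hVm : Measurable V)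
    (hV : ∀ ω, V ω ∈ Icc (0 : ℝ) 1) (hβ : 0 < β) :
    tiltedFreeEnergy μ T V β θ = β ↔ |θ| ≤ critTilt μ T V β := by
  refine ⟨fun h => ?_, fun h => (isTiltedFreeEnergy_of_abs_le hhill hT hVm hV hβ h).eq⟩
  by_contra hθ
  obtain ⟨l, hl, hlθ⟩ := exists_lyapunov_eq hT.toMeasurePreserving hVm hV hβ (not_le.1 hθ)
  rw [← tiltedFreeEnergy_abs hhill hT hVm hV hβ, ← hlθ,
    tiltedFreeEnergy_lyapunov hT hVm hV hβ hl] at h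
  exact hl.ne' h

theorem convexOn_tiltedFreeEnergy
    (hhill : ∀ h ∈ Ioo (0 : ℝ) 1, ∀ m : ℕ, 1 ≤ m → 0 < μ {ω | IsHill T V ω h 0 m})
    (hT : Ergodic T μ) (hVm : Measurable V)
    (hV : ∀ ω, V ω ∈ Icc (0 : ℝ) 1) (hβ : 0 < β) :
    ConvexOn ℝ univ fun θ => tiltedFreeEnergy μ T V β θ := by
  refine ⟨convex_univ, fun x _ y _ a b ha hb hab => ?_⟩
  have hf := isTiltedFreeEnergy_tiltedFreeEnergy hhill hT hVm hV hβ
  refine (hf x).convex (hf y) ha hb hab ?_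
  rw [← add_mul, hab, one_mul]
  exact hf (a * x + b * y)

theorem le_tiltedFreeEnergy
    (hhill : ∀ h ∈ Ioo (0 : ℝ) 1, ∀ m : ℕ, 1 ≤ m → 0 < μ {ω | IsHill T V ω h 0 m})
    (hT : Ergodic T μ) (hVm : Measurable V)
    (hV : ∀ ω, V ω ∈ Icc (0 : ℝ) 1) (hβ : 0 < β) (θ : ℝ) :
    max β (β * (∫ ω, V ω ∂μ) + Real.log (Real.cosh θ)) ≤ tiltedFreeEnergy μ T V β θ := by
  by_cases h : |θ| ≤ critTilt μ T V β
  · rw [(tiltedFreeEnergy_eq_iff hhill hT hVm hV hβ).2 h]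
    refine max_le le_rfl (le_of_forall_gt_imp_ge_of_dense fun l hl => ?_)
    have h1 := log_cosh_lyapunov_le (μ := μ) hT.toMeasurePreserving hVm hV hβ hl
    have h2 : Real.log (Real.cosh θ) ≤ Real.log (Real.cosh (lyapunov μ T V β l)) :=
      Real.log_le_log (Real.cosh_pos _) (Real.cosh_le_cosh.2
        ((h.trans (critTilt_le_lyapunov hVm hV hβ hl)).trans (le_abs_self _)))
    linarith
  · obtain ⟨l, hl, hlθ⟩ := exists_lyapunov_eq hT.toMeasurePreserving hVm hV hβ (not_le.1 h)
    rw [← tiltedFreeEnergy_abs hhill hT hVm hV hβ, ← Real.cosh_abs θ, ← hlθ,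
      tiltedFreeEnergy_lyapunov hT hVm hV hβ hl]
    have h1 := log_cosh_lyapunov_le (μ := μ) hT.toMeasurePreserving hVm hV hβ hl
    exact max_le hl.le (by linarith)

/-- As a function of the inverse temperature the free energy is convex on `[0, ∞)` and lies
strictly above its value `log cosh θ` at `0`; hence it is strictly increasing. -/
theorem strictMonoOn_tiltedFreeEnergy
    (hhill : ∀ h ∈ Ioo (0 : ℝ) 1, ∀ m : ℕ, 1 ≤ m → 0 < μ {ω | IsHill T V ω h 0 m})
    (hT : Ergodic T μ) (hVm : Measurable V)
    (hV : ∀ ω, V ω ∈ Icc (0 : ℝ) 1) (hsup : essSup V μ = 1) (θ : ℝ) :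
    StrictMonoOn (fun β => tiltedFreeEnergy μ T V β θ) (Ioi 0) := by
  intro β (hβ : 0 < β) β' (hβ' : 0 < β') hlt
  have hf := fun β (hβ : 0 < β) => isTiltedFreeEnergy_tiltedFreeEnergy hhill hT hVm hV hβ θ
  have ht : β / β' < 1 := (div_lt_one hβ').2 hlt
  have ht0 : 0 < β / β' := by positivity
  have hpos : Real.log (Real.cosh θ) < tiltedFreeEnergy μ T V β θ := by
    have h1 := (le_max_right _ _).trans (le_tiltedFreeEnergy hhill hT hVm hV hβ θ)
    have h2 := mul_pos hβ (integral_potential_pos (μ := μ) hVm hV hsup)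
    linarith
  have h := (isTiltedFreeEnergy_zero_left (μ := μ) (T := T) (V := V) (θ := θ)).convex (hf β' hβ')
    (a := 1 - β / β') (b := β / β') (by linarith) ht0.le (by ring)
    (m := tiltedFreeEnergy μ T V β θ) (by
      rw [mul_zero, zero_add, div_mul_cancel₀ _ hβ'.ne', ← add_mul, sub_add_cancel, one_mul]
      exact hf β hβ)
  have h3 := mul_lt_mul_of_pos_left hpos (show 0 < 1 - β / β' by linarith)
  show tiltedFreeEnergy μ T V β θ < tiltedFreeEnergy μ T V β' θ
  by_contra hcon
  have h4 := mul_le_mul_of_nonneg_left (not_lt.1 hcon) ht0.le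
  linarith

/-- The free energy at large tilts is a high level, where the increments of the eigenfunction are
large. -/
theorem tendsto_tiltedFreeEnergy_sub_log_cosh
    (hhill : ∀ h ∈ Ioo (0 : ℝ) 1, ∀ m : ℕ, 1 ≤ m → 0 < μ {ω | IsHill T V ω h 0 m})
    (hT : Ergodic T μ) (hVm : Measurable V)
    (hV : ∀ ω, V ω ∈ Icc (0 : ℝ) 1) (hβ : 0 < β) :
    Tendsto (fun θ => tiltedFreeEnergy μ T V β θ - Real.log (Real.cosh θ)) atTop
      (𝓝 (β * ∫ ω, V ω ∂μ)) := by
  have hlow : ∀ θ, β * ∫ ω, V ω ∂μ ≤ tiltedFreeEnergy μ T V β θ - Real.log (Real.cosh θ) :=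
    fun θ => by
      linarith [(le_max_right _ _).trans (le_tiltedFreeEnergy hhill hT hVm hV hβ θ)]
  have hE : 0 ≤ ∫ ω, V ω ∂μ := integral_nonneg fun ω => (hV ω).1
  have hup : ∀ᶠ θ in atTop, tiltedFreeEnergy μ T V β θ - Real.log (Real.cosh θ) ≤
      β * (∫ ω, V ω ∂μ) + Real.exp (-(2 * (θ - Real.log 2 - β))) := by
    filter_upwards [eventually_gt_atTop (critTilt μ T V β)] with θ hθ
    obtain ⟨l, hl, rfl⟩ := exists_lyapunov_eq hT.toMeasurePreserving hVm hV hβ hθ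
    rw [tiltedFreeEnergy_lyapunov hT hVm hV hβ hl]
    have h1 := sub_mul_integral_le_log_cosh_add (μ := μ) hT.toMeasurePreserving hVm hV hβ hl
    have h2 := log_cosh_lyapunov_le (μ := μ) hT.toMeasurePreserving hVm hV hβ hl
    have h3 := sub_log_two_le_log_cosh (lyapunov μ T V β l)
    have h4 : Real.exp (-(2 * (l - β))) ≤
        Real.exp (-(2 * (lyapunov μ T V β l - Real.log 2 - β))) :=
      Real.exp_le_exp.2 (by linarith [mul_nonneg hβ.le hE])
    linarith
  refine tendsto_of_tendsto_of_tendsto_of_le_of_le' tendsto_const_nhds ?_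
    (Eventually.of_forall hlow) hup
  have h0 : Tendsto (fun θ : ℝ => 2 * (θ - Real.log 2 - β)) atTop atTop := by
    refine Tendsto.const_mul_atTop two_pos ?_
    simp only [sub_eq_add_neg]
    exact tendsto_atTop_add_const_right _ _ (tendsto_atTop_add_const_right _ _ tendsto_id)
  simpa using (Real.tendsto_exp_neg_atTop_nhds_zero.comp h0).const_add (β * ∫ ω, V ω ∂μ)

theorem hasDerivAt_tiltedFreeEnergy
    (hhill : ∀ h ∈ Ioo (0 : ℝ) 1, ∀ m : ℕ, 1 ≤ m → 0 < μ {ω | IsHill T V ω h 0 m})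
    (hT : Ergodic T μ) (hVm : Measurable V)
    (hV : ∀ ω, V ω ∈ Icc (0 : ℝ) 1) (hβ : 0 < β) (hθ : critTilt μ T V β < θ) :
    HasDerivAt (fun θ => tiltedFreeEnergy μ T V β θ)
      (lyapunovDeriv μ T V β (tiltedFreeEnergy μ T V β θ))⁻¹ θ := by
  have hcont : Continuous fun θ => tiltedFreeEnergy μ T V β θ :=
    continuousOn_univ.1
      ((convexOn_tiltedFreeEnergy hhill hT hVm hV hβ).continuousOn isOpen_univ)
  have hinv : ∀ θ, critTilt μ T V β < θ → β < tiltedFreeEnergy μ T V β θ ∧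
      lyapunov μ T V β (tiltedFreeEnergy μ T V β θ) = θ := by
    intro θ hθ
    obtain ⟨l, hl, rfl⟩ := exists_lyapunov_eq hT.toMeasurePreserving hVm hV hβ hθ
    rw [tiltedFreeEnergy_lyapunov hT hVm hV hβ hl]
    exact ⟨hl, rfl⟩
  refine HasDerivAt.of_local_left_inverse hcont.continuousAt
    (hasDerivAt_lyapunov' hT.toMeasurePreserving hVm hV hβ (hinv θ hθ).1) ?_ ?_
  · linarith [one_le_lyapunovDeriv (μ := μ) (T := T) hVm hV hβ (hinv θ hθ).1]
  · filter_upwards [lt_mem_nhds hθ] with θ' hθ'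
    exact (hinv θ' hθ').2

theorem contDiffOn_tiltedFreeEnergy_Ioi
    (hhill : ∀ h ∈ Ioo (0 : ℝ) 1, ∀ m : ℕ, 1 ≤ m → 0 < μ {ω | IsHill T V ω h 0 m})
    (hT : Ergodic T μ) (hVm : Measurable V)
    (hV : ∀ ω, V ω ∈ Icc (0 : ℝ) 1) (hβ : 0 < β) :
    ContDiffOn ℝ 1 (fun θ => tiltedFreeEnergy μ T V β θ) (Ioi (critTilt μ T V β)) := by
  have hd := fun θ (hθ : critTilt μ T V β < θ) =>
    hasDerivAt_tiltedFreeEnergy hhill hT hVm hV hβ hθ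
  have hone : (1 : WithTop ℕ∞) = 0 + 1 := (zero_add 1).symm
  rw [hone, contDiffOn_succ_iff_deriv_of_isOpen isOpen_Ioi]
  refine ⟨fun θ hθ => (hd θ hθ).differentiableAt.differentiableWithinAt, by simp, ?_⟩
  rw [contDiffOn_zero]
  refine ContinuousOn.congr (f := fun θ =>
    (lyapunovDeriv μ T V β (tiltedFreeEnergy μ T V β θ))⁻¹) (fun θ hθ => ?_)
    fun θ hθ => (hd θ hθ).deriv
  obtain ⟨l, hl, rfl⟩ := exists_lyapunov_eq hT.toMeasurePreserving hVm hV hβ hθ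
  have e := tiltedFreeEnergy_lyapunov hT hVm hV hβ hl
  refine ContinuousAt.continuousWithinAt (ContinuousAt.inv₀ ?_ ?_)
  · refine ContinuousAt.comp (g := fun l => lyapunovDeriv μ T V β l) ?_ (hd _ hθ).continuousAt
    rw [e]
    exact continuousAt_lyapunovDeriv hVm hV hβ hl
  · rw [e]
    linarith [one_le_lyapunovDeriv (μ := μ) (T := T) hVm hV hβ hl]

theorem contDiffOn_tiltedFreeEnergy
    (hhill : ∀ h ∈ Ioo (0 : ℝ) 1, ∀ m : ℕ, 1 ≤ m → 0 < μ {ω | IsHill T V ω h 0 m})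
    (hT : Ergodic T μ) (hVm : Measurable V)
    (hV : ∀ ω, V ω ∈ Icc (0 : ℝ) 1) (hβ : 0 < β) :
    ContDiffOn ℝ 1 (fun θ => tiltedFreeEnergy μ T V β θ)
      {θ : ℝ | tiltedFreeEnergy μ T V β θ = β}ᶜ := by
  have h1 := contDiffOn_tiltedFreeEnergy_Ioi hhill hT hVm hV hβ
  have h2 : ContDiffOn ℝ 1 (fun θ => tiltedFreeEnergy μ T V β θ) (Iio (-critTilt μ T V β)) := by
    have h := h1.comp (s := Iio (-critTilt μ T V β)) contDiff_neg.contDiffOn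
      fun θ (hθ : θ < -critTilt μ T V β) => lt_neg.1 hθ
    exact h.congr fun θ _ => (tiltedFreeEnergy_neg hhill hT hVm hV hβ θ).symm
  refine (h1.union_of_isOpen h2 isOpen_Ioi isOpen_Iio).mono fun θ hθ => ?_
  have hθ' : ¬ tiltedFreeEnergy μ T V β θ = β := hθ
  rw [tiltedFreeEnergy_eq_iff hhill hT hVm hV hβ, not_le, lt_abs] at hθ'
  rcases hθ' with h | h
  · exact Or.inl h
  · exact Or.inr (lt_neg.1 h)

end Inverse

end RWRP
end

theorem proposition4p8 {Ω : Type*} [MeasurableSpace Ω] (μ : Measure Ω) [IsProbabilityMeasure μ]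
    (T : Ω ≃ᵐ Ω) (hT : Ergodic T μ)
    (V : Ω → ℝ) (hVmeas : Measurable V) (hV : ∀ ω, V ω ∈ Icc (0 : ℝ) 1)
    (hinf : essInf V μ = 0) (hsup : essSup V μ = 1)
    (hvalley : ∀ h ∈ Ioo (0 : ℝ) 1, ∀ l : ℕ, 1 ≤ l → 0 < μ {ω | RWRP.IsValley T V ω h 0 l})
    (hhill : ∀ h ∈ Ioo (0 : ℝ) 1, ∀ l : ℕ, 1 ≤ l → 0 < μ {ω | RWRP.IsHill T V ω h 0 l}) :
    -- the almost sure limit that defines the tilted free energy exists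
    (∀ β : ℝ, 0 < β → ∀ θ : ℝ,
      RWRP.IsTiltedFreeEnergy μ T V β θ (RWRP.tiltedFreeEnergy μ T V β θ)) ∧
    -- (a) monotone in the inverse temperature; even and convex in the tilt
    (∀ θ : ℝ, StrictMonoOn (fun β => RWRP.tiltedFreeEnergy μ T V β θ) (Ioi 0)) ∧
    (∀ β : ℝ, 0 < β →
      (∀ θ : ℝ, RWRP.tiltedFreeEnergy μ T V β (-θ) = RWRP.tiltedFreeEnergy μ T V β θ) ∧
      ConvexOn ℝ univ (fun θ => RWRP.tiltedFreeEnergy μ T V β θ) ∧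
      -- (b)
      (∀ θ : ℝ, max β (β * (∫ ω, V ω ∂μ) + Real.log (Real.cosh θ))
        ≤ RWRP.tiltedFreeEnergy μ T V β θ) ∧
      -- (c)
      (∀ θ : ℝ, |θ| ≤ β * (1 - ∫ ω, V ω ∂μ) → RWRP.tiltedFreeEnergy μ T V β θ = β) ∧
      (∃ b : ℝ, 0 < b ∧ {θ : ℝ | RWRP.tiltedFreeEnergy μ T V β θ = β} = Icc (-b) b) ∧
      -- (d)
      Tendsto (fun θ => RWRP.tiltedFreeEnergy μ T V β θ - Real.log (Real.cosh θ)) atTop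
        (𝓝 (β * ∫ ω, V ω ∂μ)) ∧
      Tendsto (fun θ => RWRP.tiltedFreeEnergy μ T V β θ - Real.log (Real.cosh θ)) atBot
        (𝓝 (β * ∫ ω, V ω ∂μ)) ∧
      -- (e)
      ContDiffOn ℝ 1 (fun θ => RWRP.tiltedFreeEnergy μ T V β θ)
        {θ : ℝ | RWRP.tiltedFreeEnergy μ T V β θ = β}ᶜ) := by
  have hElt := RWRP.integral_potential_lt_one (μ := μ) hVmeas hV hinf
  refine ⟨fun β hβ θ => RWRP.isTiltedFreeEnergy_tiltedFreeEnergy hhill hT hVmeas hV hβ θ,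
    RWRP.strictMonoOn_tiltedFreeEnergy hhill hT hVmeas hV hsup, fun β hβ => ?_⟩
  have hcrit := RWRP.mul_one_sub_le_critTilt (μ := μ) hT.toMeasurePreserving hVmeas hV hβ
  have heq := fun θ => RWRP.tiltedFreeEnergy_eq_iff hhill (θ := θ) hT hVmeas hV hβ
  have htop := RWRP.tendsto_tiltedFreeEnergy_sub_log_cosh hhill hT hVmeas hV hβ
  refine ⟨RWRP.tiltedFreeEnergy_neg hhill hT hVmeas hV hβ,
    RWRP.convexOn_tiltedFreeEnergy hhill hT hVmeas hV hβ,
    RWRP.le_tiltedFreeEnergy hhill hT hVmeas hV hβ, fun θ hθ => (heq θ).2 (hθ.trans hcrit),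
    ⟨RWRP.critTilt μ T V β, ?_, ?_⟩, htop, ?_,
    RWRP.contDiffOn_tiltedFreeEnergy hhill hT hVmeas hV hβ⟩
  · exact (mul_pos hβ (sub_pos.2 hElt)).trans_le hcrit
  · ext θ
    exact (heq θ).trans abs_le
  · refine (htop.comp tendsto_neg_atBot_atTop).congr fun θ => ?_
    simp only [Function.comp_apply, Real.cosh_neg,
      RWRP.tiltedFreeEnergy_neg hhill hT hVmeas hV hβ θ]
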